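/- **Setting.** Let $d,T\ge 1$. Paths are $x=(x_1,\dots,x_T)\in\mathbb R^{dT}$ with $x_t\in\mathbb R^d$, and $x_{1:t}=(x_1,\dots,x_t)$; for $x\in\mathbb R^n$ and $p\ge1$, $|x|_p^p=\sum_{k=1}^n|x_k|^p$. Let $\mu,\nu$ be Borel probability measures on $\mathbb R^{dT}$, and let $\nu_{x_{1:t}}$ be the conditional law under $\nu$ of the coordinate $X_{t+1}$ given $X_{1:t}=x_{1:t}$. A coupling $\pi$ of $\mu$ and $\nu$, with canonical process $(X,Y)$, is *bicausal* if for $t=1,\dots,T-1$ the conditional law of $Y_{1:t}$ given $X$ equals that given $X_{1:t}$, and the conditional law of $X_{1:t}$ given $Y$ equals that given $Y_{1:t}$ ($\pi$-a.s.). For a measurable $w:\mathbb R^{dT}\to[0,\infty)$, let $\mathrm{TV}_w(\mu,\nu)$, resp. $\mathrm{ATV}_w(\mu,\nu)$, be the infimum of $\int_{\{x\ne y\}}(w(x)+w(y))\,d\pi(x,y)$ over all couplings, resp. all bicausal couplings, $\pi$ of $\mu$ and $\nu$. Put $\mathrm{TV}(\mu,\nu)=|\mu-\nu|(\mathbb R^{dT})$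 (which is $\mathrm{TV}_1$), $\mathrm{ATV}=\mathrm{ATV}_1$, and, with $w(x)=1+|x|_p^p$, $\mathrm{TV}_p=(\mathrm{TV}_w)^{1/p}$ and $\mathrm{ATV}_p=(\mathrm{ATV}_w)^{1/p}$. **Conditional weighting.** For constants $c_2,\dots,c_T\ge 0$ suppose that there are measurable $w_t:\mathbb R^{dt}\to[0,\infty)$, $t=1,\dots,T$, with $w_T=w$, such that for $t=2,\dots,T$ $$w_{t-1}(x_{1:t-1})\le w_t(x_{1:t})\ \text{ for } (\mu+\nu)\text{-a.e. }x,\qquad \int w_t(x_{1:t-1},\tilde x_t)\,\nu_{x_{1:t-1}}(d\tilde x_t)\le(1+c_t)\,w_{t-1}(x_{1:t-1})\ \text{ for }\nu\text{-a.e. }x. \tag{CW}$$ **Theorem.** 1. If (CW) holds and $\int w\,d(\mu+\nu)<\infty$, then $$\mathrm{ATV}_w(\mu,\nu)\le\Big(1+2\sum_{t=1}^{T-1}\prod_{s=t+1}^{T}(1+c_s)\Big)\mathrm{TV}_w(\mu,\nu).$$ 2. In particular $\mathrm{ATV}(\mu,\nu)\le(2T-1)\,\mathrm{TV}(\mu,\nu)$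 for all $\mu,\nu$; and if $p\ge1$ and $\mu,\nu$ have finite $p$-th moments, then $$\mathrm{ATV}_p^p(\mu,\nu)\le\Big(1+2\sum_{t=1}^{T-1}\prod_{s=t+1}^{T}(1+c_s)\Big)\mathrm{TV}_p^p(\mu,\nu),\qquad c_t=\nu\text{-}\operatorname{ess\,sup}\frac{\mathbb E_\nu[|X_t|_p^p\mid X_1,\dots,X_{t-1}]}{1+\sum_{s=1}^{t-1}|X_s|_p^p}$$ (with $c_t\in[0,\infty]$ and $\infty\cdot0=0$). 3. The constants are sharp. For $\epsilon\in(0,1)$ put $q=\big(\tfrac{2\epsilon}{1+\epsilon}\big)^{1/(T-1)}$ (and $q=1$ if $T=1$). For $i=1,\dots,T$ and $j\in\{1,-1\}$ let $x^{i,j}\in\mathbb R^{dT}$ be the path with all $d$ coordinates of $x^{i,j}_t$ equal to $j$ for $t\le i$ and to $j+1$ for $t>i$. Put $\gamma_2^i=\frac{1+\epsilon}2(1-q)q^{i-1}$ for $i<T$, $\gamma_2^T=\frac{1+\epsilon}2q^{T-1}$, $\gamma_1^i=\gamma_2^i$ for $i<T$, $\gamma_1^T=\gamma_2^T-\epsilon$,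 and $$\mu_\epsilon=\sum_{i=1}^T\big(\gamma_1^i\delta_{x^{i,1}}+\gamma_2^i\delta_{x^{i,-1}}\big),\qquad \nu_\epsilon=\sum_{i=1}^T\big(\gamma_2^i\delta_{x^{i,1}}+\gamma_1^i\delta_{x^{i,-1}}\big).$$ For all $c_2,\dots,c_T\ge0$ there is a measurable $w:\mathbb R^{dT}\to[0,\infty)$ such that for every $\epsilon\in(0,1)$ the probability measures $\mu_\epsilon,\nu_\epsilon$ satisfy (CW) with these constants, $\int w\,d(\mu_\epsilon+\nu_\epsilon)<\infty$, $0<\mathrm{TV}_w(\mu_\epsilon,\nu_\epsilon)<\infty$, and $$\lim_{\epsilon\to0}\frac{\mathrm{ATV}_w(\mu_\epsilon,\nu_\epsilon)}{\mathrm{TV}_w(\mu_\epsilon,\nu_\epsilon)}=1+2\sum_{t=1}^{T-1}\prod_{s=t+1}^{T}(1+c_s).$$ Moreover $0<\mathrm{TV}(\mu_\epsilon,\nu_\epsilon)<\infty$ for $\epsilon\in(0,1)$ and $\lim_{\epsilon\to0}\mathrm{ATV}(\mu_\epsilon,\nu_\epsilon)/\mathrm{TV}(\mu_\epsilon,\nu_\epsilon)=2T-1$.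 -/

import Mathlib

open MeasureTheory ProbabilityTheory Filter Topology
open scoped NNReal ENNReal

namespace AdaptedTV

/-- The path space `(ℝ^d)^T`; a path is `x = (x_1, …, x_T)`, the time `t ∈ {1, …, T}` of the
mathematics being the index `t - 1 : Fin T`. -/
abbrev PathSpace (d T : ℕ) : Type := Fin T → Fin d → ℝ

variable {d T : ℕ}

/-- The initial segment `x_{1:s} = (x_1, …, x_s)` of a path. -/
def hist (s : ℕ) (hs : s ≤ T) (x : PathSpace d T) : PathSpace d s := fun i => x (Fin.castLE hs i)

/-- The kernel `ν_{x_{1:s}}(dx_{s+1})` of `ν`: the regular conditional law of the coordinate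
`x_{s+1}` given `x_{1:s}`. -/
noncomputable def stepKernel (ν : Measure (PathSpace d T)) [IsFiniteMeasure ν] (s : ℕ) (hs : s < T) :
    Kernel (PathSpace d s) (Fin d → ℝ) :=
  condDistrib (fun x : PathSpace d T => x ⟨s, hs⟩) (hist s hs.le) ν

/-- `π` is a coupling of `μ` and `ν`. -/
def IsCoupling (μ ν : Measure (PathSpace d T)) (π : Measure (PathSpace d T × PathSpace d T)) : Prop :=
  π.map Prod.fst = μ ∧ π.map Prod.snd = ν

/-- Bicausality: for `t = 1, …, T - 1`, the conditional law of `Y_{1:t}` given the whole path `X`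
is its conditional law given `X_{1:t}`, and the same with the roles of `X` and `Y` exchanged. -/
def IsBicausal (π : Measure (PathSpace d T × PathSpace d T)) [IsFiniteMeasure π] : Prop :=
  ∀ (t : ℕ) (ht : t < T), 1 ≤ t →
    (∀ᵐ z ∂π,
      condDistrib (fun z : PathSpace d T × PathSpace d T => hist t ht.le z.2) Prod.fst π z.1 =
        condDistrib (fun z : PathSpace d T × PathSpace d T => hist t ht.le z.2)
          (fun z => hist t ht.le z.1) π (hist t ht.le z.1)) ∧
    (∀ᵐ z ∂π,
      condDistrib (fun z : PathSpace d T × PathSpace d T => hist t ht.le z.1) Prod.snd π z.2 =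
        condDistrib (fun z : PathSpace d T × PathSpace d T => hist t ht.le z.1)
          (fun z => hist t ht.le z.2) π (hist t ht.le z.2))

/-- The cost `∫_{x ≠ y} (w(x) + w(y)) dπ(x, y)`. -/
noncomputable def offDiagCost (w : PathSpace d T → ℝ≥0) (π : Measure (PathSpace d T × PathSpace d T)) : ℝ≥0∞ :=
  ∫⁻ z in {z : PathSpace d T × PathSpace d T | z.1 ≠ z.2}, ((w z.1 : ℝ≥0∞) + w z.2) ∂π

/-- The weighted total variation distance `TV_w`. -/
noncomputable def tvW (w : PathSpace d T → ℝ≥0) (μ ν : Measure (PathSpace d T)) : ℝ≥0∞ :=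
  ⨅ (π : ProbabilityMeasure (PathSpace d T × PathSpace d T))
    (_ : IsCoupling μ ν (π : Measure (PathSpace d T × PathSpace d T))),
    offDiagCost w (π : Measure (PathSpace d T × PathSpace d T))

/-- The weighted adapted total variation distance `ATV_w`. -/
noncomputable def atvW (w : PathSpace d T → ℝ≥0) (μ ν : Measure (PathSpace d T)) : ℝ≥0∞ :=
  ⨅ (π : ProbabilityMeasure (PathSpace d T × PathSpace d T))
    (_ : IsCoupling μ ν (π : Measure (PathSpace d T × PathSpace d T)))
    (_ : IsBicausal (π : Measure (PathSpace d T × PathSpace d T))),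
    offDiagCost w (π : Measure (PathSpace d T × PathSpace d T))

/-- The total variation `∫ |μ - ν|(dx)`: the mass of the variation of the signed measure
`μ - ν`. -/
noncomputable def tv (μ ν : Measure (PathSpace d T)) [IsFiniteMeasure μ] [IsFiniteMeasure ν] : ℝ≥0∞ :=
  (μ.toSignedMeasure - ν.toSignedMeasure).totalVariation Set.univ

/-- The adapted total variation. -/
noncomputable def atv (μ ν : Measure (PathSpace d T)) : ℝ≥0∞ := atvW (fun _ => 1) μ ν

/-- `|y|_p^p = ∑_k |y_k|^p` on `ℝ^d`. -/
noncomputable def stateNormPow (p : ℝ) (y : Fin d → ℝ) : ℝ≥0 := ∑ k, ‖y k‖₊ ^ p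

/-- `|x|_p^p = ∑_t |x_t|_p^p` on the path space. -/
noncomputable def pathNormPow (p : ℝ) (x : PathSpace d T) : ℝ≥0 := ∑ t, stateNormPow p (x t)

/-- The total variation distance of order `p`. -/
noncomputable def tvP (p : ℝ) (μ ν : Measure (PathSpace d T)) : ℝ≥0∞ :=
  tvW (fun x => 1 + pathNormPow p x) μ ν ^ (1 / p)

/-- The adapted total variation distance of order `p`. -/
noncomputable def atvP (p : ℝ) (μ ν : Measure (PathSpace d T)) : ℝ≥0∞ :=
  atvW (fun x => 1 + pathNormPow p x) μ ν ^ (1 / p)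

/-- The conditional weighting condition with constants `c_2, …, c_T`: there are
`w_t : (ℝ^d)^t → [0, ∞)`, `t = 1, …, T`, with `w_T = w`, such that for `t = s + 1 ∈ {2, …, T}`
`w_{t-1}(x_{1:t-1}) ≤ w_t(x_{1:t})` along almost all paths of `μ` and of `ν`, and
`∫ w_t(x_{1:t-1}, y) ν_{x_{1:t-1}}(dy) ≤ (1 + c_t) w_{t-1}(x_{1:t-1})` for `ν`-almost all `x`. -/
def ConditionalWeighting (μ ν : Measure (PathSpace d T)) [IsFiniteMeasure ν] (w : PathSpace d T → ℝ≥0)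
    (c : ℕ → ℝ≥0) : Prop :=
  ∃ W : (t : ℕ) → PathSpace d t → ℝ≥0,
    (∀ t, Measurable (W t)) ∧ W T = w ∧
    (∀ᵐ x ∂(μ + ν), ∀ (s : ℕ) (hs : s < T), 1 ≤ s →
      W s (hist s hs.le x) ≤ W (s + 1) (hist (s + 1) hs x)) ∧
    (∀ᵐ x ∂ν, ∀ (s : ℕ) (hs : s < T), 1 ≤ s →
      ∫⁻ y, (W (s + 1) (Fin.snoc (α := fun _ => Fin d → ℝ) (hist s hs.le x) y) : ℝ≥0∞)
          ∂(stepKernel ν s hs (hist s hs.le x)) ≤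
        (1 + (c (s + 1) : ℝ≥0∞)) * (W s (hist s hs.le x) : ℝ≥0∞))

/-- The constant `1 + 2 ∑_{t=1}^{T-1} ∏_{s=t+1}^T (1 + c_s)`. -/
noncomputable def boundConst (T : ℕ) (c : ℕ → ℝ≥0∞) : ℝ≥0∞ :=
  1 + 2 * ∑ t ∈ Finset.Icc 1 (T - 1), ∏ s ∈ Finset.Icc (t + 1) T, (1 + c s)

/-- The number
`c_t = ν-ess sup E_ν[|X_t|_p^p | X_1, …, X_{t-1}] / (1 + ∑_{s<t} |X_s|_p^p) ∈ [0, ∞]`,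
for `t = 2, …, T`; the conditional expectation is the integral against the kernel
`ν_{x_{1:t-1}}`. -/
noncomputable def momentConst (p : ℝ) (ν : Measure (PathSpace d T)) [IsFiniteMeasure ν] (t : ℕ) :
    ℝ≥0∞ :=
  if h : t - 1 < T then
    essSup (fun x : PathSpace d T =>
      (∫⁻ y, (stateNormPow p y : ℝ≥0∞) ∂(stepKernel ν (t - 1) h (hist (t - 1) h.le x))) /
        (1 + (pathNormPow p (hist (t - 1) h.le x) : ℝ≥0∞))) ν
  else 0

/-! The tree-supported measures that attain the constant in the limit `ε → 0`. -/

/-- The path `x^{i,j}`: it starts in `j`, stays there up to and including the time of index `i`,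
and equals `j + 1` afterwards (in each of the `d` coordinates). -/
def treePath (d T : ℕ) (i : Fin T) (j : ℝ) : PathSpace d T := fun t _ => j + if i < t then 1 else 0

/-- The transition parameter `p = (2ε / (1 + ε))^{1/(T-1)}`. -/
noncomputable def treeP (T : ℕ) (ε : ℝ) : ℝ := (2 * ε / (1 + ε)) ^ (1 / ((T : ℝ) - 1))

/-- The masses of `γ₂`, of total mass `(1 + ε) / 2`: at each node of the trunk the path stays in
the trunk with probability `p` and leaves it for good with probability `1 - p`. -/
noncomputable def treeMass₂ (T : ℕ) (ε : ℝ) (i : Fin T) : ℝ :=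
  (1 + ε) / 2 * (treeP T ε ^ (i : ℕ) * if (i : ℕ) + 1 < T then 1 - treeP T ε else 1)

/-- The masses of `γ₁`, of total mass `(1 - ε) / 2`: those of `γ₂` except at the last leaf. -/
noncomputable def treeMass₁ (T : ℕ) (ε : ℝ) (i : Fin T) : ℝ :=
  treeMass₂ T ε i - if (i : ℕ) + 1 < T then 0 else ε

/-- The measure `μ_ε`: `γ₁` started in `1` plus `γ₂` started in `-1`. -/
noncomputable def treeMu (d T : ℕ) (ε : ℝ) : Measure (PathSpace d T) :=
  ∑ i : Fin T, ((treeMass₁ T ε i).toNNReal • Measure.dirac (treePath d T i 1) +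
    (treeMass₂ T ε i).toNNReal • Measure.dirac (treePath d T i (-1)))

/-- The measure `ν_ε`: `γ₂` started in `1` plus `γ₁` started in `-1`. -/
noncomputable def treeNu (d T : ℕ) (ε : ℝ) : Measure (PathSpace d T) :=
  ∑ i : Fin T, ((treeMass₂ T ε i).toNNReal • Measure.dirac (treePath d T i 1) +
    (treeMass₁ T ε i).toNNReal • Measure.dirac (treePath d T i (-1)))

instance (d T : ℕ) (ε : ℝ) : IsFiniteMeasure (treeMu d T ε) := by
  unfold treeMu; infer_instance

instance (d T : ℕ) (ε : ℝ) : IsFiniteMeasure (treeNu d T ε) := by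
  unfold treeNu; infer_instance

end AdaptedTV

open AdaptedTV

/-! A coupling of `μ` and `ν` leaves a common part `α` on the diagonal: `μ = α + β`, `ν = α + β'`,
and its cost is K = ∫ w dβ + ∫ w dβ'. So it suffices to find, for each such splitting, a bicausal
coupling whose cost is at most the constant times K.

That coupling is built one time step at a time. While the two paths agree, their next states come
from a maximal coupling of the transition kernels, which puts the common part `θ` of the kernels on
the diagonal (`exists_couplingKernel`). Once the paths differ, the next states are independent. The
next state of each path has a law depending on that path's own past only, which keeps the coupling
causal in both directions (`IsCausal.extendPair`).

Let l_n be the diagonal mass obtained by following `θ` up to time n. The invariant is α_n ≤ l_n +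
Q_n, where Q_n bounds what has been lost. The laws of `μ` and `ν` up to time n both lie below ρ =
l_n + Q_n + β_n + β'_n. Hence α_{n+1} lies below ρ extended by either kernel, and so below ρ
extended by `θ` (`map_hist_succ_le_extend`). The share of l_n in this is l_{n+1}; the rest is
Q_{n+1}. Since `θ` is dominated by the kernel of `ν`, conditional weighting gives ∫ w_{n+1} dQ_{n+1}
≤ (1 + c_{n+1}) (∫ w_n dQ_n + K), and Q_1 = 0 leads to the sum of products
(`exists_causalCoupling_of_common_part`). Mass of `α` that misses the diagonal is paid for in both
marginals, hence the factor 2, while K itself is paid once (`atvW_le_of_common_part`).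

For sharpness, the tree measures differ only by mass ε at their two last leaves, which have weight
1, so TV_w ≤ 2ε. Yet every trunk node has mass m under one measure and m - ε under the other.
Bicausality then allows at most (m - ε)(1 - q) of diagonal mass at the leaf hanging off that node, a
loss of ε(1 - q) on each side (`IsBicausal.tree_diag_le`). A weight that grows by 1 + c_s off the
trunk gives these leaves the weights ∏ (1 + c_s). Thus ATV_w ≥ 2ε (1 + 2(1 - q) ∑ ∏), and q → 0. -/

namespace AdaptedTV

variable {d T n : ℕ}

/-! ### Maximal coupling of two kernels -/

/-- Two Markov kernels have a common part `θ`, which contains every measure dominated by both of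
their semidirect products with the same measure, and a coupling kernel that puts `θ` on the
diagonal. -/
theorem exists_couplingKernel {α E : Type*} [MeasurableSpace α] [MeasurableSpace E]
    [MeasurableSpace.CountablyGenerated E] (κ η : Kernel α E) [IsMarkovKernel κ]
    [IsMarkovKernel η] :
    ∃ (θ : Kernel α E) (γ : Kernel α (E × E)), IsFiniteKernel θ ∧ IsMarkovKernel γ ∧
      (∀ x, (γ x).map Prod.fst = κ x) ∧ (∀ x, (γ x).map Prod.snd = η x) ∧
      (∀ x, (θ x).map (fun y => (y, y)) ≤ γ x) ∧ (∀ x, θ x ≤ η x) ∧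
      ∀ (ρ : Measure α) [SFinite ρ] (σ : Measure (α × E)),
        σ ≤ ρ ⊗ₘ κ → σ ≤ ρ ⊗ₘ η → σ ≤ ρ ⊗ₘ θ := by
  set τ := κ + η with hτ
  set f := Kernel.rnDeriv κ τ with hf
  set g := Kernel.rnDeriv η τ with hg
  have hfm : Measurable (Function.uncurry f) := Kernel.measurable_rnDeriv κ τ
  have hgm : Measurable (Function.uncurry g) := Kernel.measurable_rnDeriv η τ
  have hκ : ∀ x, (τ x).withDensity (f x) = κ x := fun x => by
    rw [← Kernel.withDensity_apply τ hfm]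
    refine Kernel.withDensity_rnDeriv_eq (Measure.absolutelyContinuous_of_le ?_)
    rw [hτ, add_apply]; exact Measure.le_add_right le_rfl
  have hη : ∀ x, (τ x).withDensity (g x) = η x := fun x => by
    rw [← Kernel.withDensity_apply τ hgm]
    refine Kernel.withDensity_rnDeriv_eq (Measure.absolutelyContinuous_of_le ?_)
    rw [hτ, add_apply]; exact Measure.le_add_left le_rfl
  have hm : Measurable (Function.uncurry fun x y => min (f x y) (g x y)) := hfm.min hgm
  have hfg : Measurable (Function.uncurry fun x y => f x y - g x y) := hfm.sub hgm
  have hgf : Measurable (Function.uncurry fun x y => g x y - f x y) := hgm.sub hfm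
  set θ := Kernel.withDensity τ fun x y => min (f x y) (g x y) with hθ
  set κ' := Kernel.withDensity τ fun x y => f x y - g x y with hκ'
  set η' := Kernel.withDensity τ fun x y => g x y - f x y with hη'
  have hκs : ∀ x, θ x + κ' x = κ x := fun x => by
    rw [hθ, hκ', Kernel.withDensity_apply _ hm, Kernel.withDensity_apply _ hfg, ← hκ x,
      ← withDensity_add_left (hm.of_uncurry_left (x := x))]
    congr 1; ext y
    rcases le_total (f x y) (g x y) with h | h
    · simp [min_eq_left h, tsub_eq_zero_of_le h]
    · simp [min_eq_right h, add_tsub_cancel_of_le h]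
  have hηs : ∀ x, θ x + η' x = η x := fun x => by
    rw [hθ, hη', Kernel.withDensity_apply _ hm, Kernel.withDensity_apply _ hgf, ← hη x,
      ← withDensity_add_left (hm.of_uncurry_left (x := x))]
    congr 1; ext y
    rcases le_total (f x y) (g x y) with h | h
    · simp [min_eq_left h, add_tsub_cancel_of_le h]
    · simp [min_eq_right h, tsub_eq_zero_of_le h]
  have hθκ : ∀ x, θ x ≤ κ x := fun x => by rw [← hκs x]; exact Measure.le_add_right le_rfl
  have hθη : ∀ x, θ x ≤ η x := fun x => by rw [← hηs x]; exact Measure.le_add_right le_rfl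
  have hκκ : ∀ x, κ' x ≤ κ x := fun x => by rw [← hκs x]; exact Measure.le_add_left le_rfl
  have hηη : ∀ x, η' x ≤ η x := fun x => by rw [← hηs x]; exact Measure.le_add_left le_rfl
  have fθ : IsFiniteKernel θ := ⟨1, ENNReal.one_lt_top, fun x => (hθκ x _).trans prob_le_one⟩
  have fκ : IsFiniteKernel κ' := ⟨1, ENNReal.one_lt_top, fun x => (hκκ x _).trans prob_le_one⟩
  have fη : IsFiniteKernel η' := ⟨1, ENNReal.one_lt_top, fun x => (hηη x _).trans prob_le_one⟩
  have hmass : ∀ x, κ' x Set.univ = η' x Set.univ := fun x => by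
    have h1 : θ x Set.univ + κ' x Set.univ = 1 := by
      rw [← Measure.add_apply, hκs]; exact measure_univ
    have h2 : θ x Set.univ + η' x Set.univ = 1 := by
      rw [← Measure.add_apply, hηs]; exact measure_univ
    exact (ENNReal.add_right_inj (measure_ne_top _ _)).1 (h1.trans h2.symm)
  have hr : Measurable (Function.uncurry fun (x : α) (_ : E × E) => (κ' x Set.univ)⁻¹) :=
    ((κ'.measurable_coe MeasurableSet.univ).comp measurable_fst).inv
  have hd : Measurable fun y : E => (y, y) := measurable_id.prodMk measurable_id
  -- The residuals `κ'` and `η'` have equal mass, so their product divided by that mass has them as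
  -- marginals. Where the mass is 0 the density is `∞` against the zero measure and contributes
  -- nothing.
  set γ := θ.map (fun y => (y, y)) + Kernel.withDensity (κ' ×ₖ η')
    (fun x _ => (κ' x Set.univ)⁻¹) with hγ
  have hγx : ∀ x, γ x = (θ x).map (fun y => (y, y)) +
      (κ' x Set.univ)⁻¹ • (κ' x).prod (η' x) := fun x => by
    rw [hγ, add_apply, Kernel.map_apply _ hd, Kernel.withDensity_apply _ hr,
      Kernel.prod_apply, withDensity_const]
  have hcancel : ∀ x (a : ℝ≥0∞), a ≤ κ' x Set.univ →
      (κ' x Set.univ)⁻¹ * (a * κ' x Set.univ) = a := fun x a ha => by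
    rcases eq_or_ne (κ' x Set.univ) 0 with h | h
    · have : a = 0 := le_antisymm (h ▸ ha) zero_le
      simp [this]
    · rw [mul_comm a, ← mul_assoc, ENNReal.inv_mul_cancel h (measure_ne_top _ _), one_mul]
  have hfst : ∀ x, (γ x).map Prod.fst = κ x := fun x => by
    rw [hγx, Measure.map_add _ _ measurable_fst, Measure.map_map measurable_fst hd,
      ← hκs x]
    congr 1
    · exact Measure.map_id
    · rw [Measure.map_smul, Measure.map_fst_prod]
      ext s hs
      simp only [Measure.smul_apply, smul_eq_mul, ← hmass]
      rw [mul_comm (κ' x Set.univ) (κ' x s)]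
      exact hcancel x _ (measure_mono (Set.subset_univ _))
  have hsnd : ∀ x, (γ x).map Prod.snd = η x := fun x => by
    rw [hγx, Measure.map_add _ _ measurable_snd, Measure.map_map measurable_snd hd,
      ← hηs x]
    congr 1
    · exact Measure.map_id
    · rw [Measure.map_smul, Measure.map_snd_prod]
      ext s hs
      simp only [Measure.smul_apply, smul_eq_mul]
      rw [mul_comm (κ' x Set.univ) (η' x s)]
      exact hcancel x _ ((measure_mono (Set.subset_univ _)).trans (hmass x).ge)
  refine ⟨θ, γ, fθ, ⟨fun x => ⟨?_⟩⟩, hfst, hsnd, fun x => ?_, hθη, fun ρ _ σ h1 h2 => ?_⟩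
  · have := hfst x ▸ (Measure.map_apply (μ := γ x) measurable_fst MeasurableSet.univ)
    rw [Set.preimage_univ] at this
    rw [← this]; exact measure_univ
  · rw [hγx]; exact Measure.le_add_right le_rfl
  · refine Measure.le_iff.2 fun A hA => ?_
    -- On `S` the minimum of the densities is that of `η`, off `S` that of `κ`; each bound on `σ` is
    -- used on its own piece.
    set S : Set (α × E) := {z | g z.1 z.2 ≤ f z.1 z.2} with hS
    have hSm : MeasurableSet S := measurableSet_le hgm hfm
    have k1 : (ρ ⊗ₘ η) (A ∩ S) = (ρ ⊗ₘ θ) (A ∩ S) := by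
      rw [Measure.compProd_apply (hA.inter hSm), Measure.compProd_apply (hA.inter hSm)]
      refine lintegral_congr fun x => ?_
      have hB := measurable_prodMk_left (x := x) (hA.inter hSm)
      rw [← hη x, hθ, Kernel.withDensity_apply _ hm, withDensity_apply _ hB,
        withDensity_apply _ hB]
      exact setLIntegral_congr_fun hB fun y hy => (min_eq_right hy.2).symm
    have k2 : (ρ ⊗ₘ κ) (A \ S) = (ρ ⊗ₘ θ) (A \ S) := by
      rw [Measure.compProd_apply (hA.diff hSm), Measure.compProd_apply (hA.diff hSm)]
      refine lintegral_congr fun x => ?_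
      have hB := measurable_prodMk_left (x := x) (hA.diff hSm)
      rw [← hκ x, hθ, Kernel.withDensity_apply _ hm, withDensity_apply _ hB,
        withDensity_apply _ hB]
      exact setLIntegral_congr_fun hB fun y hy => (min_eq_left (not_le.1 hy.2).le).symm
    rw [← measure_inter_add_sdiff A hSm, ← measure_inter_add_sdiff (μ := ρ ⊗ₘ θ) A hSm, ← k1, ← k2]
    exact add_le_add (h2 _) (h1 _)

/-! ### Paths and pairs of paths extended by one step -/

@[fun_prop]
theorem measurable_hist (s : ℕ) (hs : s ≤ T) : Measurable (hist (d := d) s hs) :=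
  measurable_pi_lambda _ fun _ => measurable_pi_apply _

/-- The path extended by one more state. -/
def snocPath (z : PathSpace d n × (Fin d → ℝ)) : PathSpace d (n + 1) :=
  Fin.snoc (α := fun _ => Fin d → ℝ) z.1 z.2

@[fun_prop]
theorem measurable_snocPath : Measurable (snocPath (d := d) (n := n)) := by
  refine measurable_pi_lambda _ fun i => ?_
  induction i using Fin.lastCases with
  | last => simpa [snocPath] using measurable_snd
  | cast i =>
    simp only [snocPath, Fin.snoc_castSucc]
    exact (measurable_pi_apply i).comp measurable_fst

theorem hist_snocPath {s : ℕ} (hs : s ≤ n) (z : PathSpace d n × (Fin d → ℝ)) :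
    hist s (hs.trans n.le_succ) (snocPath z) = hist s hs z.1 := by
  funext i
  exact Fin.snoc_castSucc (α := fun _ => Fin d → ℝ) _ _ (Fin.castLE hs i)

theorem snocPath_hist (h : n < T) (x : PathSpace d T) :
    snocPath (hist n h.le x, x ⟨n, h⟩) = hist (n + 1) h x := by
  funext i
  induction i using Fin.lastCases with
  | last => simp [snocPath, hist]; rfl
  | cast i => simp [snocPath, hist]

/-- The law on paths obtained from a law on shorter paths and a transition kernel. -/
noncomputable def extend (ρ : Measure (PathSpace d n)) (κ : Kernel (PathSpace d n) (Fin d → ℝ)) :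
    Measure (PathSpace d (n + 1)) :=
  (ρ ⊗ₘ κ).map snocPath

instance (ν : Measure (PathSpace d T)) [IsFiniteMeasure ν] (s : ℕ) (hs : s < T) :
    IsMarkovKernel (stepKernel ν s hs) := by
  unfold stepKernel; infer_instance

theorem map_hist_succ (ν : Measure (PathSpace d T)) [IsFiniteMeasure ν] (h : n < T) :
    ν.map (hist (n + 1) h) = extend (ν.map (hist n h.le)) (stepKernel ν n h) := by
  rw [extend, stepKernel, compProd_map_condDistrib (measurable_pi_apply _).aemeasurable,
    Measure.map_map measurable_snocPath ((measurable_hist _ _).prodMk (measurable_pi_apply _))]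
  congr 1
  funext x
  exact (snocPath_hist h x).symm

theorem lintegral_extend (ρ : Measure (PathSpace d n)) [SFinite ρ]
    (κ : Kernel (PathSpace d n) (Fin d → ℝ)) [IsSFiniteKernel κ]
    {F : PathSpace d (n + 1) → ℝ≥0∞} (hF : Measurable F) :
    ∫⁻ x, F x ∂(extend ρ κ) = ∫⁻ x, ∫⁻ y, F (snocPath (x, y)) ∂(κ x) ∂ρ := by
  rw [extend, lintegral_map hF measurable_snocPath,
    Measure.lintegral_compProd (by fun_prop)]

/-- The law on pairs of paths obtained from a law on pairs of shorter paths and a transition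
kernel. -/
noncomputable def extendPair (π : Measure (PathSpace d n × PathSpace d n))
    (Γ : Kernel (PathSpace d n × PathSpace d n) ((Fin d → ℝ) × (Fin d → ℝ))) :
    Measure (PathSpace d (n + 1) × PathSpace d (n + 1)) :=
  (π ⊗ₘ Γ).map fun z => (snocPath (z.1.1, z.2.1), snocPath (z.1.2, z.2.2))

theorem lintegral_extendPair (π : Measure (PathSpace d n × PathSpace d n)) [SFinite π]
    (Γ : Kernel (PathSpace d n × PathSpace d n) ((Fin d → ℝ) × (Fin d → ℝ))) [IsSFiniteKernel Γ]
    {F : PathSpace d (n + 1) × PathSpace d (n + 1) → ℝ≥0∞} (hF : Measurable F) :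
    ∫⁻ x, F x ∂(extendPair π Γ) =
      ∫⁻ z, ∫⁻ e, F (snocPath (z.1, e.1), snocPath (z.2, e.2)) ∂(Γ z) ∂π := by
  rw [extendPair, lintegral_map hF (by fun_prop), Measure.lintegral_compProd (by fun_prop)]

instance (π : Measure (PathSpace d n × PathSpace d n)) [IsProbabilityMeasure π]
    (Γ : Kernel (PathSpace d n × PathSpace d n) ((Fin d → ℝ) × (Fin d → ℝ))) [IsMarkovKernel Γ] :
    IsProbabilityMeasure (extendPair π Γ) :=
  Measure.isProbabilityMeasure_map (by fun_prop)

theorem map_fst_extendPair (π : Measure (PathSpace d n × PathSpace d n)) [IsProbabilityMeasure π]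
    (Γ : Kernel (PathSpace d n × PathSpace d n) ((Fin d → ℝ) × (Fin d → ℝ))) [IsMarkovKernel Γ]
    (κ : Kernel (PathSpace d n) (Fin d → ℝ)) [IsMarkovKernel κ]
    (hΓ : ∀ z, (Γ z).map Prod.fst = κ z.1) :
    (extendPair π Γ).map Prod.fst = extend (π.map Prod.fst) κ := by
  refine Measure.ext_of_lintegral _ fun F hF => ?_
  have : SFinite (π.map Prod.fst) := inferInstance
  rw [lintegral_map hF measurable_fst, lintegral_extendPair _ _ (by fun_prop),
    lintegral_extend _ _ hF, lintegral_map _ measurable_fst]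
  · refine lintegral_congr fun z => ?_
    rw [← hΓ z, lintegral_map (by fun_prop) measurable_fst]
  · exact Measurable.lintegral_kernel_prod_right' (f := fun z => F (snocPath z)) (by fun_prop)

/-- Exchange of the two paths. -/
theorem map_swap_extendPair (π : Measure (PathSpace d n × PathSpace d n)) [IsProbabilityMeasure π]
    (Γ : Kernel (PathSpace d n × PathSpace d n) ((Fin d → ℝ) × (Fin d → ℝ))) [IsMarkovKernel Γ] :
    (extendPair π Γ).map Prod.swap =
      extendPair (π.map Prod.swap) ((Γ.comap Prod.swap measurable_swap).map Prod.swap) := by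
  refine Measure.ext_of_lintegral _ fun F hF => ?_
  have : IsMarkovKernel ((Γ.comap Prod.swap measurable_swap).map Prod.swap) :=
    Kernel.IsMarkovKernel.map _ measurable_swap
  rw [lintegral_map hF measurable_swap, lintegral_extendPair _ _ (by fun_prop),
    lintegral_extendPair _ _ hF, lintegral_map _ measurable_swap]
  · refine lintegral_congr fun z => ?_
    rw [Kernel.map_apply _ measurable_swap, Kernel.comap_apply, Prod.swap_swap,
      lintegral_map (by fun_prop) measurable_swap]
    rfl
  · exact Measurable.lintegral_kernel_prod_right'
      (f := fun z : (PathSpace d n × PathSpace d n) × ((Fin d → ℝ) × (Fin d → ℝ)) =>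
        F (snocPath (z.1.1, z.2.1), snocPath (z.1.2, z.2.2))) (by fun_prop)

/-! ### Causality and its propagation -/

/-- Causality of a law on pairs of paths: given the first path, the initial segments of the second
path depend on the initial segments of the first one only. -/
def IsCausal (π : Measure (PathSpace d n × PathSpace d n)) : Prop :=
  ∀ (t : ℕ) (ht : t ≤ n), ∃ κ : Kernel (PathSpace d t) (PathSpace d t), IsMarkovKernel κ ∧
    π.map (fun z => (z.1, hist t ht z.2)) =
      (π.map Prod.fst) ⊗ₘ κ.comap (hist t ht) (measurable_hist t ht)

theorem exists_disintegration (π : Measure (PathSpace d n × PathSpace d n))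
    [IsProbabilityMeasure π] :
    ∃ κ : Kernel (PathSpace d n) (PathSpace d n), IsMarkovKernel κ ∧
      π.map (fun z => (z.1, hist n le_rfl z.2)) =
        (π.map Prod.fst) ⊗ₘ κ.comap (hist n le_rfl) (measurable_hist n le_rfl) :=
  ⟨π.condKernel, inferInstance, by
    have h1 : (fun z : PathSpace d n × PathSpace d n => (z.1, hist n le_rfl z.2)) = id := rfl
    rw [h1, Measure.map_id]
    exact (π.disintegrate π.condKernel).symm⟩

/-- Given the pair of pasts, the new state of the first path is drawn from a kernel that sees the
first past only. It is therefore conditionally independent of the second past and adds no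
information about it, so the kernel that worked before the extension still works. At the final time
the condition is mere disintegration. -/
theorem IsCausal.extendPair {π : Measure (PathSpace d n × PathSpace d n)} [IsProbabilityMeasure π]
    (hπ : IsCausal π)
    (Γ : Kernel (PathSpace d n × PathSpace d n) ((Fin d → ℝ) × (Fin d → ℝ))) [IsMarkovKernel Γ]
    (κ : Kernel (PathSpace d n) (Fin d → ℝ)) [IsMarkovKernel κ]
    (hΓ : ∀ z, (Γ z).map Prod.fst = κ z.1) : IsCausal (extendPair π Γ) := by
  intro t ht
  rcases Nat.lt_or_eq_of_le ht with h | rfl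
  swap
  · exact exists_disintegration _
  have ht' : t ≤ n := Nat.lt_succ_iff.1 h
  obtain ⟨ξ, hξ, hξπ⟩ := hπ t ht'
  refine ⟨ξ, hξ, ?_⟩
  have : IsProbabilityMeasure (π.map Prod.fst) :=
    Measure.isProbabilityMeasure_map measurable_fst.aemeasurable
  have : SFinite (extend (π.map Prod.fst) κ) := by unfold extend; infer_instance
  rw [map_fst_extendPair π Γ κ hΓ]
  refine Measure.ext_of_lintegral _ fun F hF => ?_
  have hG : Measurable fun z : PathSpace d n × PathSpace d t =>
      ∫⁻ y, F (snocPath (z.1, y), z.2) ∂(κ z.1) :=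
    Measurable.lintegral_kernel_prod_right' (κ := κ.comap Prod.fst measurable_fst)
      (f := fun w : (PathSpace d n × PathSpace d t) × (Fin d → ℝ) =>
        F (snocPath (w.1.1, w.2), w.1.2)) (by fun_prop)
  have hF2 : Measurable fun x : PathSpace d (n + 1) =>
      ∫⁻ b, F (x, b) ∂(ξ.comap (hist t ht) (measurable_hist t ht) x) :=
    Measurable.lintegral_kernel_prod_right' hF
  calc ∫⁻ z, F z ∂((AdaptedTV.extendPair π Γ).map fun z => (z.1, hist t ht z.2))
      = ∫⁻ z, ∫⁻ e, F (snocPath (z.1, e.1), hist t ht' z.2) ∂(Γ z) ∂π := by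
        rw [lintegral_map hF (by fun_prop), lintegral_extendPair _ _ (by fun_prop)]
        simp only [hist_snocPath ht']
    _ = ∫⁻ z, ∫⁻ y, F (snocPath (z.1, y), hist t ht' z.2) ∂(κ z.1) ∂π := by
        refine lintegral_congr fun z => ?_
        rw [← hΓ z, lintegral_map (by fun_prop) measurable_fst]
    _ = ∫⁻ z, ∫⁻ y, F (snocPath (z.1, y), z.2) ∂(κ z.1)
          ∂(π.map fun z => (z.1, hist t ht' z.2)) := by
        rw [lintegral_map hG (by fun_prop)]
    _ = ∫⁻ x, ∫⁻ b, ∫⁻ y, F (snocPath (x, y), b) ∂(κ x) ∂(ξ (hist t ht' x))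
          ∂(π.map Prod.fst) := by
        rw [hξπ, Measure.lintegral_compProd hG]; rfl
    -- Conditional independence in the form of Fubini: `κ x` and `ξ (hist t ht' x)` both depend on
    -- `x` alone.
    _ = ∫⁻ x, ∫⁻ y, ∫⁻ b, F (snocPath (x, y), b) ∂(ξ (hist t ht' x)) ∂(κ x)
          ∂(π.map Prod.fst) := by
        refine lintegral_congr fun x => ?_
        exact lintegral_lintegral_swap (by fun_prop)
    _ = _ := by
        rw [Measure.lintegral_compProd hF, lintegral_extend _ _ hF2]
        simp only [Kernel.comap_apply, hist_snocPath ht']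

/-- Translates a factorization through `h` into conditional laws: by uniqueness, `κ` is a version of
the conditional law given `h (X)`, and `κ` composed with `h` one given `X`. This connects
`IsCausal`, convenient for induction, with `IsBicausal`. -/
theorem condDistrib_comp_ae_eq {Ω A A' B : Type*} [MeasurableSpace Ω] [MeasurableSpace A]
    [MeasurableSpace A'] [MeasurableSpace B] [StandardBorelSpace B] [Nonempty B]
    {P : Measure Ω} [IsFiniteMeasure P] {X : Ω → A} {Y : Ω → B} {h : A → A'}
    (hX : Measurable X) (hY : Measurable Y) (hh : Measurable h) (κ : Kernel A' B)
    [IsMarkovKernel κ] (hκ : P.map (fun ω => (X ω, Y ω)) = (P.map X) ⊗ₘ κ.comap h hh) :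
    ∀ᵐ ω ∂P, condDistrib Y X P (X ω) = condDistrib Y (fun ω => h (X ω)) P (h (X ω)) := by
  have h1 := ae_of_ae_map hX.aemeasurable
    (condDistrib_ae_eq_of_measure_eq_compProd_of_measurable hX hY hκ)
  have h2 : P.map (fun ω => (h (X ω), Y ω)) = (P.map fun ω => h (X ω)) ⊗ₘ κ := by
    have e : P.map (fun ω => (h (X ω), Y ω)) =
        (P.map (fun ω => (X ω, Y ω))).map (Prod.map h id) := by
      rw [Measure.map_map (by fun_prop) (by fun_prop)]; rfl
    rw [e, hκ]
    refine Measure.ext_of_lintegral _ fun F hF => ?_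
    rw [lintegral_map hF (by fun_prop), Measure.lintegral_compProd (by fun_prop),
      Measure.lintegral_compProd hF, lintegral_map (by fun_prop) hX,
      lintegral_map (Measurable.lintegral_kernel_prod_right' hF) (by fun_prop)]
    rfl
  have h3 := ae_of_ae_map (hh.comp hX).aemeasurable
    (condDistrib_ae_eq_of_measure_eq_compProd_of_measurable (hh.comp hX) hY h2)
  filter_upwards [h1, h3] with ω a b
  rw [a, Kernel.comap_apply]
  exact b.symm

theorem IsCausal.isBicausal {π : Measure (PathSpace d T × PathSpace d T)} [IsProbabilityMeasure π]
    (h : IsCausal π) (h' : IsCausal (π.map Prod.swap)) : IsBicausal π := by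
  intro t ht _
  obtain ⟨κ, _, hκ⟩ := h t ht.le
  obtain ⟨κ', _, hκ'⟩ := h' t ht.le
  refine ⟨condDistrib_comp_ae_eq measurable_fst (by fun_prop) (measurable_hist t ht.le) κ hκ,
    condDistrib_comp_ae_eq measurable_snd (by fun_prop) (measurable_hist t ht.le) κ' ?_⟩
  rw [Measure.map_map (by fun_prop) measurable_swap,
    Measure.map_map measurable_fst measurable_swap] at hκ'
  exact hκ'

/-! ### The stepwise causal coupling and its diagonal -/

theorem compProd_mono_left {A B : Type*} [MeasurableSpace A] [MeasurableSpace B]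
    {ρ σ : Measure A} [SFinite ρ] [SFinite σ] (h : ρ ≤ σ) (κ : Kernel A B) [IsSFiniteKernel κ] :
    ρ ⊗ₘ κ ≤ σ ⊗ₘ κ := by
  refine Measure.le_iff.2 fun s hs => ?_
  rw [Measure.compProd_apply hs, Measure.compProd_apply hs]
  exact lintegral_mono' h le_rfl

/-- `π` couples the laws of the first `n` states under `μ` and `ν` and is causal in both
directions. -/
structure IsCausalCoupling (μ ν : Measure (PathSpace d T)) (n : ℕ) (h : n ≤ T)
    (π : Measure (PathSpace d n × PathSpace d n)) : Prop where
  prob : IsProbabilityMeasure π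
  causal : IsCausal π
  causal_swap : IsCausal (π.map Prod.swap)
  map_fst : π.map Prod.fst = μ.map (hist n h)
  map_snd : π.map Prod.snd = ν.map (hist n h)

theorem map_hist_zero (μ : Measure (PathSpace d T)) [IsProbabilityMeasure μ] :
    μ.map (hist 0 (Nat.zero_le T)) = Measure.dirac (Fin.elim0 : PathSpace d 0) := by
  have : hist (d := d) 0 (Nat.zero_le T) = fun _ => Fin.elim0 := by
    funext x; exact Subsingleton.elim _ _
  rw [this, Measure.map_const, measure_univ, one_smul]

theorem isCausalCoupling_zero (μ ν : Measure (PathSpace d T)) [IsProbabilityMeasure μ]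
    [IsProbabilityMeasure ν] :
    IsCausalCoupling μ ν 0 (Nat.zero_le T)
      (Measure.dirac ((Fin.elim0 : PathSpace d 0), (Fin.elim0 : PathSpace d 0))) := by
  have hc : ∀ π : Measure (PathSpace d 0 × PathSpace d 0), IsProbabilityMeasure π → IsCausal π := by
    intro π _ t ht
    obtain rfl := Nat.le_zero.1 ht
    exact exists_disintegration π
  refine ⟨inferInstance, hc _ inferInstance, hc _ ?_, ?_, ?_⟩
  · exact Measure.isProbabilityMeasure_map measurable_swap.aemeasurable
  · rw [map_hist_zero, Measure.map_dirac' measurable_fst]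
  · rw [map_hist_zero, Measure.map_dirac' measurable_snd]

theorem map_snd_extendPair (π : Measure (PathSpace d n × PathSpace d n)) [IsProbabilityMeasure π]
    (Γ : Kernel (PathSpace d n × PathSpace d n) ((Fin d → ℝ) × (Fin d → ℝ))) [IsMarkovKernel Γ]
    (η : Kernel (PathSpace d n) (Fin d → ℝ)) [IsMarkovKernel η]
    (hΓ : ∀ z, (Γ z).map Prod.snd = η z.2) :
    (extendPair π Γ).map Prod.snd = extend (π.map Prod.snd) η := by
  have : IsMarkovKernel ((Γ.comap Prod.swap measurable_swap).map Prod.swap) :=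
    Kernel.IsMarkovKernel.map _ measurable_swap
  have : IsProbabilityMeasure (π.map Prod.swap) :=
    Measure.isProbabilityMeasure_map measurable_swap.aemeasurable
  have h := map_fst_extendPair (π.map Prod.swap)
    ((Γ.comap Prod.swap measurable_swap).map Prod.swap) η (fun z => by
    rw [Kernel.map_apply _ measurable_swap, Measure.map_map measurable_fst measurable_swap]
    exact hΓ z.swap)
  rw [← map_swap_extendPair, Measure.map_map measurable_fst measurable_swap,
    Measure.map_map measurable_fst measurable_swap] at h
  exact h

theorem IsCausalCoupling.extendPair {μ ν : Measure (PathSpace d T)} [IsFiniteMeasure μ]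
    [IsFiniteMeasure ν] {h : n < T} {π : Measure (PathSpace d n × PathSpace d n)}
    (hπ : IsCausalCoupling μ ν n h.le π)
    (Γ : Kernel (PathSpace d n × PathSpace d n) ((Fin d → ℝ) × (Fin d → ℝ))) [IsMarkovKernel Γ]
    (h1 : ∀ z, (Γ z).map Prod.fst = stepKernel μ n h z.1)
    (h2 : ∀ z, (Γ z).map Prod.snd = stepKernel ν n h z.2) :
    IsCausalCoupling μ ν (n + 1) h (extendPair π Γ) := by
  have := hπ.prob
  have : IsMarkovKernel ((Γ.comap Prod.swap measurable_swap).map Prod.swap) :=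
    Kernel.IsMarkovKernel.map _ measurable_swap
  have : IsProbabilityMeasure (π.map Prod.swap) :=
    Measure.isProbabilityMeasure_map measurable_swap.aemeasurable
  refine ⟨inferInstance, hπ.causal.extendPair Γ _ h1, ?_, ?_, ?_⟩
  · rw [map_swap_extendPair]
    refine hπ.causal_swap.extendPair _ (stepKernel ν n h) fun z => ?_
    rw [Kernel.map_apply _ measurable_swap, Measure.map_map measurable_fst measurable_swap]
    exact h2 z.swap
  · rw [map_fst_extendPair π Γ _ h1, hπ.map_fst, map_hist_succ]
  · rw [map_snd_extendPair π Γ _ h2, hπ.map_snd, map_hist_succ]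

/-- Diagonal mass is followed through a step as a sub-measure: where the paths agree, `Γ` keeps at
least `θ` on the diagonal. -/
theorem map_diag_extend_le {π : Measure (PathSpace d n × PathSpace d n)} [SFinite π]
    {l : Measure (PathSpace d n)} [SFinite l]
    (hl : l.map (fun x => (x, x)) ≤ π)
    (Γ : Kernel (PathSpace d n × PathSpace d n) ((Fin d → ℝ) × (Fin d → ℝ))) [IsMarkovKernel Γ]
    (θ : Kernel (PathSpace d n) (Fin d → ℝ)) [IsFiniteKernel θ]
    (hθ : ∀ x, (θ x).map (fun y => (y, y)) ≤ Γ (x, x)) :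
    (extend l θ).map (fun x => (x, x)) ≤ extendPair π Γ := by
  refine Measure.le_iff.2 fun s hs => ?_
  have hF : Measurable (s.indicator (1 : PathSpace d (n + 1) × PathSpace d (n + 1) → ℝ≥0∞)) :=
    measurable_one.indicator hs
  rw [← lintegral_indicator_one hs, ← lintegral_indicator_one hs]
  generalize s.indicator (1 : PathSpace d (n + 1) × PathSpace d (n + 1) → ℝ≥0∞) = F at hF
  have hG : Measurable fun z : PathSpace d n × PathSpace d n =>
      ∫⁻ e, F (snocPath (z.1, e.1), snocPath (z.2, e.2)) ∂(Γ z) :=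
    Measurable.lintegral_kernel_prod_right'
      (f := fun z : (PathSpace d n × PathSpace d n) × ((Fin d → ℝ) × (Fin d → ℝ)) =>
        F (snocPath (z.1.1, z.2.1), snocPath (z.1.2, z.2.2))) (by fun_prop)
  rw [lintegral_map hF (by fun_prop), lintegral_extend _ _ (by fun_prop),
    lintegral_extendPair _ _ hF]
  refine le_trans ?_ (lintegral_mono' hl le_rfl)
  rw [lintegral_map hG (by fun_prop)]
  refine lintegral_mono fun x => le_trans (le_of_eq ?_) (lintegral_mono' (hθ x) le_rfl)
  rw [lintegral_map (by fun_prop) (by fun_prop)]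

/-- One step of the coupling: as long as the two paths agree, their next states are coupled so that
they agree on the common part `θ` of the transition kernels. -/
theorem exists_coupling_step (μ ν : Measure (PathSpace d T)) [IsFiniteMeasure μ]
    [IsFiniteMeasure ν] (h : n < T) :
    ∃ θ : Kernel (PathSpace d n) (Fin d → ℝ), IsFiniteKernel θ ∧
      (∀ x, θ x ≤ stepKernel ν n h x) ∧
      (∀ (ρ : Measure (PathSpace d n)) [SFinite ρ] (σ : Measure (PathSpace d n × (Fin d → ℝ))),
        σ ≤ ρ ⊗ₘ stepKernel μ n h → σ ≤ ρ ⊗ₘ stepKernel ν n h → σ ≤ ρ ⊗ₘ θ) ∧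
      ∀ (π : Measure (PathSpace d n × PathSpace d n)) (l : Measure (PathSpace d n)) [SFinite l],
        IsCausalCoupling μ ν n h.le π → l.map (fun x => (x, x)) ≤ π →
        ∃ π', IsCausalCoupling μ ν (n + 1) h π' ∧ (extend l θ).map (fun x => (x, x)) ≤ π' := by
  obtain ⟨θ, γ, hθ, hγ, h1, h2, h3, h4, h5⟩ :=
    exists_couplingKernel (stepKernel μ n h) (stepKernel ν n h)
  refine ⟨θ, hθ, h4, h5, fun π l _ hπ hl => ?_⟩
  classical
  set D : Set (PathSpace d n × PathSpace d n) := {z | z.1 = z.2} with hD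
  have hDm : MeasurableSet D := measurableSet_eq_fun measurable_fst measurable_snd
  -- Off the diagonal only the marginals matter, so the independent coupling is enough.
  set Γ : Kernel (PathSpace d n × PathSpace d n) ((Fin d → ℝ) × (Fin d → ℝ)) :=
    Kernel.piecewise hDm (γ.comap Prod.fst measurable_fst)
      (((stepKernel μ n h).comap Prod.fst measurable_fst) ×ₖ
        ((stepKernel ν n h).comap Prod.snd measurable_snd)) with hΓ
  have := hπ.prob
  refine ⟨extendPair π Γ, hπ.extendPair Γ (fun z => ?_) (fun z => ?_),
    map_diag_extend_le hl Γ θ fun x => ?_⟩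
  · rw [hΓ, Kernel.piecewise_apply]
    split_ifs with hz
    · exact h1 _
    · rw [Kernel.prod_apply, Measure.map_fst_prod]; simp
  · rw [hΓ, Kernel.piecewise_apply]
    split_ifs with hz
    · rw [Kernel.comap_apply, h2, show z.1 = z.2 from hz]
    · rw [Kernel.prod_apply, Measure.map_snd_prod]; simp
  · rw [hΓ, Kernel.piecewise_apply, if_pos (show (x, x) ∈ D from rfl)]
    exact h3 x

/-- Since `α` lies below both measures and `ρ` dominates both laws of the past, the next step of `α`
lies below `ρ` extended by either kernel, hence by their common part. The measure `ρ` can be cut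
down to `G` because `α` does not charge pasts outside `G`. -/
theorem map_hist_succ_le_extend {μ ν α : Measure (PathSpace d T)} [IsFiniteMeasure μ]
    [IsFiniteMeasure ν] {h : n < T} {θ : Kernel (PathSpace d n) (Fin d → ℝ)} [IsFiniteKernel θ]
    (hθ : ∀ (ρ : Measure (PathSpace d n)) [SFinite ρ] (σ : Measure (PathSpace d n × (Fin d → ℝ))),
        σ ≤ ρ ⊗ₘ stepKernel μ n h → σ ≤ ρ ⊗ₘ stepKernel ν n h → σ ≤ ρ ⊗ₘ θ)
    (hμ : α ≤ μ) (hν : α ≤ ν) {ρ : Measure (PathSpace d n)} [SFinite ρ]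
    (hμρ : μ.map (hist n h.le) ≤ ρ) (hνρ : ν.map (hist n h.le) ≤ ρ)
    {G : Set (PathSpace d n)} (hG : MeasurableSet G) (hGα : ∀ᵐ x ∂α, hist n h.le x ∈ G) :
    α.map (hist (n + 1) h) ≤ extend (ρ.restrict G) θ := by
  have hm : Measurable fun x : PathSpace d T => (hist n h.le x, x ⟨n, h⟩) :=
    (measurable_hist _ _).prodMk (measurable_pi_apply _)
  set σ := α.map fun x : PathSpace d T => (hist n h.le x, x ⟨n, h⟩) with hσ
  have hle : ∀ (μ' : Measure (PathSpace d T)) [IsFiniteMeasure μ'], α ≤ μ' →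
      μ'.map (hist n h.le) ≤ ρ → σ ≤ ρ ⊗ₘ stepKernel μ' n h := by
    intro μ' _ h1 h2
    refine le_trans ?_ (compProd_mono_left h2 _)
    rw [stepKernel, compProd_map_condDistrib (measurable_pi_apply _).aemeasurable]
    exact Measure.map_mono h1 hm
  have hσθ := hθ ρ σ (hle μ hμ hμρ) (hle ν hν hνρ)
  have hσG : σ ≤ (ρ.restrict G) ⊗ₘ θ := by
    refine Measure.le_iff.2 fun A hA => ?_
    have hGE : MeasurableSet (Prod.fst ⁻¹' G : Set (PathSpace d n × (Fin d → ℝ))) :=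
      measurable_fst hG
    have e1 : σ A = σ (A ∩ Prod.fst ⁻¹' G) := by
      rw [hσ, Measure.map_apply hm hA, Measure.map_apply hm (hA.inter hGE)]
      refine measure_congr ?_
      filter_upwards [hGα] with x hx
      exact propext ⟨fun hxA => ⟨hxA, hx⟩, fun hxA => hxA.1⟩
    rw [e1]
    refine (hσθ _).trans (le_of_eq ?_)
    rw [Measure.compProd_apply hA, Measure.compProd_apply (hA.inter hGE), ← lintegral_indicator hG]
    refine lintegral_congr fun x => ?_
    by_cases hx : x ∈ G
    · simp [hx, Set.preimage_inter, Set.preimage_preimage]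
    · simp [hx, Set.preimage_inter, Set.preimage_preimage]
  have e2 : α.map (hist (n + 1) h) = σ.map snocPath := by
    rw [hσ, Measure.map_map measurable_snocPath hm]
    congr 1
    funext x
    exact (snocPath_hist h x).symm
  rw [e2]
  exact Measure.map_mono hσG measurable_snocPath

/-! ### Induction on time for the lost mass -/

/-- The sum `∑_{t=1}^{n-1} ∏_{s=t+1}^n (1 + c_s)`. -/
noncomputable def weightSum (c : ℕ → ℝ≥0∞) (n : ℕ) : ℝ≥0∞ :=
  ∑ t ∈ Finset.Icc 1 (n - 1), ∏ s ∈ Finset.Icc (t + 1) n, (1 + c s)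

theorem weightSum_succ (c : ℕ → ℝ≥0∞) (hn : 1 ≤ n) :
    weightSum c (n + 1) = (1 + c (n + 1)) * (weightSum c n + 1) := by
  obtain ⟨m, rfl⟩ := Nat.exists_eq_add_of_le' hn
  simp only [weightSum, Nat.add_sub_cancel]
  rw [Finset.sum_Icc_succ_top (by omega), mul_add, mul_one, Finset.mul_sum]
  congr 1
  · refine Finset.sum_congr rfl fun t ht => ?_
    rw [Finset.prod_Icc_succ_top (by have := Finset.mem_Icc.1 ht; omega), mul_comm]
  · simp

theorem hist_mono_weight {W : (t : ℕ) → PathSpace d t → ℝ≥0} {x : PathSpace d T}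
    (h : ∀ (s : ℕ) (hs : s < T), 1 ≤ s →
      W s (hist s hs.le x) ≤ W (s + 1) (hist (s + 1) hs x)) (hn : 1 ≤ n) (hnT : n ≤ T) :
    W n (hist n hnT x) ≤ W T x := by
  induction hnT using Nat.decreasingInduction with
  | self => exact le_rfl
  | of_succ k hk ih => exact (h k hk hn).trans (ih (by omega))

/-- Here `l` is the tracked mass on the diagonal and `Q` dominates the part of `α` missing from it.
At each step `Q` is replaced by the extension by `θ` of `Q` plus the two residuals, which reproduces
the recursion of `weightSum_succ`. -/
theorem exists_causalCoupling_of_common_part {μ ν α β β' : Measure (PathSpace d T)}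
    [IsProbabilityMeasure μ] [IsProbabilityMeasure ν] (hμ : α + β = μ) (hν : α + β' = ν)
    {W : (t : ℕ) → PathSpace d t → ℝ≥0} (hW : ∀ t, Measurable (W t)) {c : ℕ → ℝ≥0}
    (hmono : ∀ᵐ x ∂(μ + ν), ∀ (s : ℕ) (hs : s < T), 1 ≤ s →
      W s (hist s hs.le x) ≤ W (s + 1) (hist (s + 1) hs x))
    (hint : ∀ᵐ x ∂ν, ∀ (s : ℕ) (hs : s < T), 1 ≤ s →
      ∫⁻ y, (W (s + 1) (Fin.snoc (α := fun _ => Fin d → ℝ) (hist s hs.le x) y) : ℝ≥0∞)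
          ∂(stepKernel ν s hs (hist s hs.le x)) ≤
        (1 + (c (s + 1) : ℝ≥0∞)) * (W s (hist s hs.le x) : ℝ≥0∞))
    (hn : 1 ≤ n) (hnT : n ≤ T) :
    ∃ (π : Measure (PathSpace d n × PathSpace d n)) (l Q : Measure (PathSpace d n)),
      IsFiniteMeasure l ∧ IsFiniteMeasure Q ∧ IsCausalCoupling μ ν n hnT π ∧
      l.map (fun x => (x, x)) ≤ π ∧ α.map (hist n hnT) ≤ l + Q ∧
      ∫⁻ x, (W n x : ℝ≥0∞) ∂Q ≤ weightSum (fun t => (c t : ℝ≥0∞)) n *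
        (∫⁻ x, (W T x : ℝ≥0∞) ∂β + ∫⁻ x, (W T x : ℝ≥0∞) ∂β') := by
  have hαμ : α ≤ μ := hμ ▸ Measure.le_add_right le_rfl
  have hαν : α ≤ ν := hν ▸ Measure.le_add_right le_rfl
  have hβμ : β ≤ μ := hμ ▸ Measure.le_add_left le_rfl
  have hβν : β' ≤ ν := hν ▸ Measure.le_add_left le_rfl
  have : IsFiniteMeasure α := isFiniteMeasure_of_le μ hαμ
  have : IsFiniteMeasure β := isFiniteMeasure_of_le μ hβμ
  have : IsFiniteMeasure β' := isFiniteMeasure_of_le ν hβν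
  induction n, hn using Nat.le_induction with
  | base =>
    -- At time 0 both paths are empty and agree, so the first step loses nothing: `Q = 0`, matching
    -- the empty sum in `weightSum` at 1.
    obtain ⟨θ, _, -, hθ, hstep⟩ := exists_coupling_step μ ν (n := 0) hnT
    set l : Measure (PathSpace d 0) := Measure.dirac Fin.elim0 with hl
    obtain ⟨π, hπ, hlπ⟩ := hstep _ l (isCausalCoupling_zero μ ν) (by
      rw [hl, Measure.map_dirac' (by fun_prop)])
    refine ⟨π, extend l θ, 0, ?_, inferInstance, hπ, hlπ, ?_, by simp⟩
    · unfold extend; infer_instance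
    · have := map_hist_succ_le_extend hθ hαμ hαν (ρ := l) (map_hist_zero μ).le
        (map_hist_zero ν).le MeasurableSet.univ (Eventually.of_forall fun _ => Set.mem_univ _)
      rwa [Measure.restrict_univ, ← add_zero (extend l θ)] at this
  | succ n hn ih =>
    obtain ⟨π, l, Q, _, _, hπ, hlπ, hαQ, hQ⟩ := ih (by omega)
    have h : n < T := hnT
    obtain ⟨θ, _, hθη, hθ, hstep⟩ := exists_coupling_step μ ν h
    obtain ⟨π', hπ', hlπ'⟩ := hstep π l hπ hlπ
    have hWs : Measurable fun z : PathSpace d n × (Fin d → ℝ) =>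
        (W (n + 1) (snocPath z) : ℝ≥0∞) :=
      ((hW (n + 1)).comp measurable_snocPath).coe_nnreal_ennreal
    -- The integral bound of conditional weighting holds only `ν`-almost everywhere, whereas `Q` and
    -- the projection of `β` need not be absolutely continuous with respect to `ν`. The restriction
    -- to `G` makes the bound available everywhere it is used, at no cost to `α ≤ ν`.
    set G : Set (PathSpace d n) := {x | ∫⁻ y, (W (n + 1) (snocPath (x, y)) : ℝ≥0∞)
      ∂(stepKernel ν n h x) ≤ (1 + (c (n + 1) : ℝ≥0∞)) * (W n x : ℝ≥0∞)} with hG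
    have hGm : MeasurableSet G := measurableSet_le
      (Measurable.lintegral_kernel_prod_right' hWs) ((hW n).coe_nnreal_ennreal.const_mul _)
    have hGν : ∀ᵐ x ∂ν, hist n h.le x ∈ G := by
      filter_upwards [hint] with x hx using hx n h hn
    set B := β.map (hist n h.le) + β'.map (hist n h.le) with hB
    set Q' := (Q + B).restrict G with hQ'
    have hρ : ∀ (μ' b : Measure (PathSpace d T)), α + b = μ' → b.map (hist n h.le) ≤ B →
        μ'.map (hist n h.le) ≤ l + (Q + B) := by
      rintro _ b rfl hb
      rw [Measure.map_add _ _ (measurable_hist _ _), ← add_assoc]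
      exact add_le_add hαQ hb
    have hα' := map_hist_succ_le_extend hθ hαμ hαν (ρ := l + (Q + B))
      (hρ μ β hμ (Measure.le_add_right le_rfl)) (hρ ν β' hν (Measure.le_add_left le_rfl))
      hGm (hαν.absolutelyContinuous.ae_le hGν)
    refine ⟨π', extend l θ, extend Q' θ, ?_, ?_, hπ', hlπ', hα'.trans ?_, ?_⟩
    · unfold extend; infer_instance
    · unfold extend; infer_instance
    · rw [extend, extend, extend, ← Measure.map_add _ _ measurable_snocPath,
        ← Measure.compProd_add_left]
      refine Measure.map_mono (compProd_mono_left ?_ θ) measurable_snocPath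
      rw [Measure.restrict_add]
      exact add_le_add Measure.restrict_le_self le_rfl
    -- Monotonicity of the weights bounds the weight of a projected residual by its full weight; it
    -- is needed along `β ≤ μ` as well as `β' ≤ ν`.
    · have hb : ∀ b μ' : Measure (PathSpace d T), b ≤ μ' → μ' ≤ μ + ν →
          ∫⁻ x, (W n x : ℝ≥0∞) ∂(b.map (hist n h.le)) ≤ ∫⁻ x, (W T x : ℝ≥0∞) ∂b := by
        intro b μ' hb hμ'
        rw [lintegral_map (hW n).coe_nnreal_ennreal (measurable_hist _ _)]
        refine lintegral_mono_ae ?_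
        filter_upwards [(hb.trans hμ').absolutelyContinuous.ae_le hmono] with x hx
        exact_mod_cast hist_mono_weight hx hn h.le
      calc ∫⁻ x, (W (n + 1) x : ℝ≥0∞) ∂(extend Q' θ)
          = ∫⁻ x in G, ∫⁻ y, (W (n + 1) (snocPath (x, y)) : ℝ≥0∞) ∂(θ x) ∂(Q + B) :=
            lintegral_extend _ _ (hW (n + 1)).coe_nnreal_ennreal
        _ ≤ ∫⁻ x in G, (1 + (c (n + 1) : ℝ≥0∞)) * (W n x : ℝ≥0∞) ∂(Q + B) :=
            setLIntegral_mono ((hW n).coe_nnreal_ennreal.const_mul _) fun x hx =>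
              (lintegral_mono' (hθη x) le_rfl).trans hx
        _ ≤ ∫⁻ x, (1 + (c (n + 1) : ℝ≥0∞)) * (W n x : ℝ≥0∞) ∂(Q + B) :=
            setLIntegral_le_lintegral _ _
        _ = (1 + (c (n + 1) : ℝ≥0∞)) * (∫⁻ x, (W n x : ℝ≥0∞) ∂Q +
              (∫⁻ x, (W n x : ℝ≥0∞) ∂(β.map (hist n h.le)) +
                ∫⁻ x, (W n x : ℝ≥0∞) ∂(β'.map (hist n h.le)))) := by
            rw [lintegral_const_mul _ (hW n).coe_nnreal_ennreal, lintegral_add_measure, hB,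
              lintegral_add_measure]
        _ ≤ (1 + (c (n + 1) : ℝ≥0∞)) * (weightSum (fun t => (c t : ℝ≥0∞)) n *
              (∫⁻ x, (W T x : ℝ≥0∞) ∂β + ∫⁻ x, (W T x : ℝ≥0∞) ∂β') +
                (∫⁻ x, (W T x : ℝ≥0∞) ∂β + ∫⁻ x, (W T x : ℝ≥0∞) ∂β')) := by
            gcongr
            · exact hb β μ hβμ (Measure.le_add_right le_rfl)
            · exact hb β' ν hβν (Measure.le_add_left le_rfl)
        _ = weightSum (fun t => (c t : ℝ≥0∞)) (n + 1) *
              (∫⁻ x, (W T x : ℝ≥0∞) ∂β + ∫⁻ x, (W T x : ℝ≥0∞) ∂β') := by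
            rw [weightSum_succ _ hn]; ring

/-! ### The weighted inequality -/

theorem measurableSet_offDiag : MeasurableSet {z : PathSpace d T × PathSpace d T | z.1 ≠ z.2} :=
  (measurableSet_eq_fun measurable_fst measurable_snd).compl

/-- The cost of a coupling and the weight of its diagonal part add up to the weights of the
marginals. -/
theorem offDiagCost_add {μ ν : Measure (PathSpace d T)}
    {π : Measure (PathSpace d T × PathSpace d T)} (hπ : IsCoupling μ ν π)
    {w : PathSpace d T → ℝ≥0} (hw : Measurable w) :
    offDiagCost w π + 2 * ∫⁻ z in {z : PathSpace d T × PathSpace d T | z.1 = z.2},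
        (w z.1 : ℝ≥0∞) ∂π = ∫⁻ x, (w x : ℝ≥0∞) ∂μ + ∫⁻ x, (w x : ℝ≥0∞) ∂ν := by
  have h1 : Measurable fun z : PathSpace d T × PathSpace d T => (w z.1 : ℝ≥0∞) :=
    (hw.comp measurable_fst).coe_nnreal_ennreal
  have hs : {z : PathSpace d T × PathSpace d T | z.1 = z.2} =
      {z : PathSpace d T × PathSpace d T | z.1 ≠ z.2}ᶜ := by ext; simp
  have h2 : 2 * ∫⁻ z in {z : PathSpace d T × PathSpace d T | z.1 = z.2}, (w z.1 : ℝ≥0∞) ∂π =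
      ∫⁻ z in {z : PathSpace d T × PathSpace d T | z.1 = z.2},
        ((w z.1 : ℝ≥0∞) + w z.2) ∂π := by
    rw [← lintegral_const_mul _ h1]
    refine setLIntegral_congr_fun (hs ▸ measurableSet_offDiag.compl) fun z hz => ?_
    rw [show z.1 = z.2 from hz, two_mul]
  rw [h2, hs, offDiagCost, lintegral_add_compl _ measurableSet_offDiag, lintegral_add_left h1,
    ← hπ.1, ← hπ.2, lintegral_map hw.coe_nnreal_ennreal measurable_fst,
    lintegral_map hw.coe_nnreal_ennreal measurable_snd]

theorem IsCausalCoupling.atvW_le {μ ν : Measure (PathSpace d T)}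
    {π : Measure (PathSpace d T × PathSpace d T)} (hπ : IsCausalCoupling μ ν T le_rfl π)
    (w : PathSpace d T → ℝ≥0) : atvW w μ ν ≤ offDiagCost w π := by
  have := hπ.prob
  have hid : hist (d := d) T le_rfl = id := rfl
  refine iInf_le_of_le ⟨π, hπ.prob⟩ (iInf_le_of_le ⟨?_, ?_⟩ (iInf_le_of_le ?_ le_rfl))
  · simpa [hid] using hπ.map_fst
  · simpa [hid] using hπ.map_snd
  · exact hπ.causal.isBicausal hπ.causal_swap

/-- The identity for cost plus twice the diagonal weight turns the lower bound ∫ w dα - ∫ w dQ for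
the diagonal weight into an upper bound for the cost. -/
theorem atvW_le_of_common_part (hT : 1 ≤ T) {μ ν α β β' : Measure (PathSpace d T)}
    [IsProbabilityMeasure μ] [IsProbabilityMeasure ν] (hμ : α + β = μ) (hν : α + β' = ν)
    {w : PathSpace d T → ℝ≥0} {c : ℕ → ℝ≥0}
    (hcw : ConditionalWeighting μ ν w c) (hw : ∫⁻ x, (w x : ℝ≥0∞) ∂(μ + ν) < ∞) :
    atvW w μ ν ≤ boundConst T (fun t => (c t : ℝ≥0∞)) *
      (∫⁻ x, (w x : ℝ≥0∞) ∂β + ∫⁻ x, (w x : ℝ≥0∞) ∂β') := by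
  obtain ⟨W, hW, rfl, hmono, hint⟩ := hcw
  obtain ⟨π, l, Q, _, _, hπ, hlπ, hαQ, hQ⟩ :=
    exists_causalCoupling_of_common_part hμ hν hW hmono hint hT le_rfl
  refine (hπ.atvW_le _).trans ?_
  have hid : hist (d := d) T le_rfl = id := rfl
  have hcpl : IsCoupling μ ν π :=
    ⟨by simpa [hid] using hπ.map_fst, by simpa [hid] using hπ.map_snd⟩
  rw [hid, Measure.map_id] at hαQ
  have hWm := (hW T).coe_nnreal_ennreal
  set K := ∫⁻ x, (W T x : ℝ≥0∞) ∂β + ∫⁻ x, (W T x : ℝ≥0∞) ∂β' with hK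
  have h1 := offDiagCost_add hcpl (hW T)
  have hl : ∫⁻ x, (W T x : ℝ≥0∞) ∂l ≤
      ∫⁻ z in {z : PathSpace d T × PathSpace d T | z.1 = z.2}, (W T z.1 : ℝ≥0∞) ∂π := by
    have hD : MeasurableSet {z : PathSpace d T × PathSpace d T | z.1 = z.2} :=
      measurableSet_eq_fun measurable_fst measurable_snd
    refine le_trans (le_of_eq ?_) (lintegral_mono' (Measure.restrict_mono le_rfl hlπ) le_rfl)
    rw [Measure.restrict_map (by fun_prop) hD, lintegral_map (by fun_prop) (by fun_prop)]
    simp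
  have hα : ∫⁻ x, (W T x : ℝ≥0∞) ∂α ≤ ∫⁻ x, (W T x : ℝ≥0∞) ∂l + ∫⁻ x, (W T x : ℝ≥0∞) ∂Q :=
    (lintegral_mono' hαQ le_rfl).trans (lintegral_add_measure _ _ _).le
  set D := ∫⁻ z in {z : PathSpace d T × PathSpace d T | z.1 = z.2}, (W T z.1 : ℝ≥0∞) ∂π
  rw [lintegral_add_measure] at hw
  -- Integrability of the weight enters here: it permits cancelling the diagonal term.
  have hDfin : 2 * D ≠ ∞ := ne_top_of_le_ne_top hw.ne (h1 ▸ le_add_self)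
  refine (ENNReal.add_le_add_iff_right hDfin).1 ?_
  calc offDiagCost (W T) π + 2 * D
      = 2 * ∫⁻ x, (W T x : ℝ≥0∞) ∂α + K := by
        rw [h1, ← hμ, ← hν, lintegral_add_measure, lintegral_add_measure, hK]; ring
    _ ≤ 2 * (D + weightSum (fun t => (c t : ℝ≥0∞)) T * K) + K := by
        gcongr
        exact hα.trans (add_le_add hl hQ)
    _ = boundConst T (fun t => (c t : ℝ≥0∞)) * K + 2 * D := by
        rw [boundConst, ← weightSum]; ring

/-- The common part of two measures that a coupling puts on the diagonal. -/
theorem exists_common_part_of_isCoupling {μ ν : Measure (PathSpace d T)}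
    {π : Measure (PathSpace d T × PathSpace d T)} (hπ : IsCoupling μ ν π)
    {w : PathSpace d T → ℝ≥0} (hw : Measurable w) :
    ∃ α β β' : Measure (PathSpace d T), α + β = μ ∧ α + β' = ν ∧
      ∫⁻ x, (w x : ℝ≥0∞) ∂β + ∫⁻ x, (w x : ℝ≥0∞) ∂β' = offDiagCost w π := by
  set S := {z : PathSpace d T × PathSpace d T | z.1 ≠ z.2} with hS
  have hSm : MeasurableSet S := measurableSet_offDiag
  refine ⟨(π.restrict Sᶜ).map Prod.fst, (π.restrict S).map Prod.fst, (π.restrict S).map Prod.snd,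
    ?_, ?_, ?_⟩
  · rw [← Measure.map_add _ _ measurable_fst, add_comm, Measure.restrict_add_restrict_compl hSm]
    exact hπ.1
  · have : (π.restrict Sᶜ).map Prod.fst = (π.restrict Sᶜ).map Prod.snd := by
      refine Measure.map_congr ?_
      filter_upwards [ae_restrict_mem hSm.compl] with z hz
      simpa [hS] using hz
    rw [this, ← Measure.map_add _ _ measurable_snd, add_comm,
      Measure.restrict_add_restrict_compl hSm]
    exact hπ.2
  · rw [lintegral_map hw.coe_nnreal_ennreal measurable_fst,
      lintegral_map hw.coe_nnreal_ennreal measurable_snd, offDiagCost,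
      lintegral_add_left (by fun_prop)]

theorem boundConst_ne_zero (c : ℕ → ℝ≥0∞) : boundConst T c ≠ 0 := by
  simp [boundConst]

theorem boundConst_ne_top (c : ℕ → ℝ≥0) : boundConst T (fun t => (c t : ℝ≥0∞)) ≠ ∞ := by
  rw [boundConst]
  refine ENNReal.add_ne_top.2 ⟨by simp, ENNReal.mul_ne_top (by simp) ?_⟩
  refine ENNReal.sum_ne_top.2 fun t _ => ENNReal.prod_ne_top fun s _ => ?_
  simp

theorem atvW_le (hT : 1 ≤ T) {μ ν : Measure (PathSpace d T)}
    [IsProbabilityMeasure μ] [IsProbabilityMeasure ν]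
    {w : PathSpace d T → ℝ≥0} {c : ℕ → ℝ≥0} (hwm : Measurable w)
    (hcw : ConditionalWeighting μ ν w c) (hw : ∫⁻ x, (w x : ℝ≥0∞) ∂(μ + ν) < ∞) :
    atvW w μ ν ≤ boundConst T (fun t => (c t : ℝ≥0∞)) * tvW w μ ν := by
  rw [tvW, ENNReal.mul_iInf_of_ne (boundConst_ne_zero _) (boundConst_ne_top _)]
  refine le_iInf fun π => ?_
  rw [ENNReal.mul_iInf_of_ne (boundConst_ne_zero _) (boundConst_ne_top _)]
  refine le_iInf fun hπ => ?_
  obtain ⟨α, β, β', h1, h2, h3⟩ := exists_common_part_of_isCoupling hπ hwm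
  rw [← h3]
  exact atvW_le_of_common_part hT h1 h2 hcw hw

/-! ### Total variation and the case of constant weight -/

theorem tv_eq (μ ν : Measure (PathSpace d T)) [IsFiniteMeasure μ] [IsFiniteMeasure ν] :
    tv μ ν = (μ - ν) Set.univ + (ν - μ) Set.univ := by
  rw [tv, SignedMeasure.totalVariation, Measure.toJordanDecomposition_toSignedMeasure_sub,
    Measure.jordanDecompositionOfToSignedMeasureSub_posPart,
    Measure.jordanDecompositionOfToSignedMeasureSub_negPart, Measure.add_apply]

theorem add_sub_comm_measure (μ ν : Measure (PathSpace d T)) [IsFiniteMeasure μ]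
    [IsFiniteMeasure ν] : μ + (ν - μ) = ν + (μ - ν) := by
  have h := Measure.sub_toSignedMeasure_eq_toSignedMeasure_sub (μ := μ) (ν := ν)
  rw [sub_eq_sub_iff_add_eq_add, ← Measure.toSignedMeasure_add, ← Measure.toSignedMeasure_add,
    Measure.toSignedMeasure_eq_toSignedMeasure_iff] at h
  rw [h, add_comm]

/-- The common part is the infimum of the two measures, written as μ - (μ - ν); the residuals are
the two parts of the Jordan decomposition. -/
theorem exists_common_part_tv (μ ν : Measure (PathSpace d T)) [IsFiniteMeasure μ]
    [IsFiniteMeasure ν] :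
    ∃ α β β' : Measure (PathSpace d T), α + β = μ ∧ α + β' = ν ∧
      β Set.univ + β' Set.univ = tv μ ν := by
  have h1 : μ - (μ - ν) + (μ - ν) = μ := Measure.sub_add_cancel_of_le Measure.sub_le
  refine ⟨μ - (μ - ν), μ - ν, ν - μ, h1, ?_, (tv_eq μ ν).symm⟩
  have h2 : μ - (μ - ν) + (ν - μ) + (μ - ν) = ν + (μ - ν) := by
    rw [add_right_comm, h1, add_sub_comm_measure]
  ext s hs
  have h3 := congrArg (fun m : Measure (PathSpace d T) => m s) h2
  simp only [Measure.add_apply] at h3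
  rw [Measure.add_apply]
  exact (ENNReal.add_left_inj (measure_ne_top (μ - ν) s)).1 h3

theorem tv_le_of_common_part {μ ν α β β' : Measure (PathSpace d T)} [IsFiniteMeasure μ]
    [IsFiniteMeasure ν] (hμ : α + β = μ) (hν : α + β' = ν) :
    tv μ ν ≤ β Set.univ + β' Set.univ := by
  rw [tv_eq]
  refine add_le_add (Measure.sub_le_of_le_add ?_ _) (Measure.sub_le_of_le_add ?_ _)
  · rw [← hμ, ← hν, add_left_comm, ← add_assoc, add_comm α β, add_assoc]
    exact add_le_add le_rfl (Measure.le_add_right le_rfl)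
  · rw [← hμ, ← hν, add_left_comm, ← add_assoc, add_comm α β', add_assoc]
    exact add_le_add le_rfl (Measure.le_add_right le_rfl)

theorem eq_of_tv_eq_zero {μ ν : Measure (PathSpace d T)} [IsFiniteMeasure μ]
    [IsFiniteMeasure ν] (h : tv μ ν = 0) : μ = ν := by
  rw [tv_eq, add_eq_zero, Measure.measure_univ_eq_zero, Measure.measure_univ_eq_zero] at h
  simpa [h.1, h.2] using add_sub_comm_measure μ ν

theorem boundConst_zero (hT : 1 ≤ T) :
    boundConst T (fun _ => ((0 : ℝ≥0) : ℝ≥0∞)) = ((2 * T - 1 : ℕ) : ℝ≥0∞) := by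
  obtain ⟨m, rfl⟩ := Nat.exists_eq_add_of_le' hT
  have : 2 * (m + 1) - 1 = 1 + 2 * m := by omega
  rw [this]
  simp [boundConst]

theorem conditionalWeighting_one (μ ν : Measure (PathSpace d T)) [IsFiniteMeasure ν] :
    ConditionalWeighting μ ν (fun _ => 1) 0 := by
  refine ⟨fun _ _ => 1, fun _ => measurable_const, rfl, ?_, ?_⟩
  · exact Eventually.of_forall fun x s hs _ => le_rfl
  · refine Eventually.of_forall fun x s hs _ => ?_
    simp

theorem atv_le (hT : 1 ≤ T) (μ ν : Measure (PathSpace d T)) [IsProbabilityMeasure μ]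
    [IsProbabilityMeasure ν] : atv μ ν ≤ ((2 * T - 1 : ℕ) : ℝ≥0∞) * tv μ ν := by
  obtain ⟨α, β, β', h1, h2, h3⟩ := exists_common_part_tv μ ν
  have := atvW_le_of_common_part hT h1 h2 (conditionalWeighting_one μ ν) (by simp)
  rw [← boundConst_zero hT, ← h3, atv]
  simpa using this

/-! ### Moment weights -/

theorem measure_sub_le_tvW {w : PathSpace d T → ℝ≥0} (hw : ∀ x, 1 ≤ w x)
    (μ ν : Measure (PathSpace d T)) {s : Set (PathSpace d T)} (hs : MeasurableSet s) :
    μ s - ν s ≤ tvW w μ ν := by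
  refine le_iInf fun π => le_iInf fun hπ => ?_
  rw [tsub_le_iff_right]
  set P := (π : Measure (PathSpace d T × PathSpace d T))
  have h1 : P {z | z.1 ≠ z.2} ≤ offDiagCost w P := by
    rw [offDiagCost, ← setLIntegral_one]
    refine lintegral_mono fun z => ?_
    refine le_trans ?_ le_self_add
    exact ENNReal.one_le_coe_iff.2 (hw z.1)
  refine le_trans ?_ (add_le_add_left h1 _)
  rw [← hπ.1, ← hπ.2, Measure.map_apply measurable_fst hs, Measure.map_apply measurable_snd hs]
  -- If the first path lies in `s`, then either the paths differ or the second lies in `s` too.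
  refine le_trans (measure_mono fun z hz => ?_) (measure_union_le _ _)
  by_cases h : z.1 = z.2
  · right; rwa [Set.mem_preimage, ← h]
  · left; exact h

theorem eq_of_tvW_eq_zero {w : PathSpace d T → ℝ≥0} (hw : ∀ x, 1 ≤ w x)
    {μ ν : Measure (PathSpace d T)} [IsProbabilityMeasure μ] [IsProbabilityMeasure ν]
    (h : tvW w μ ν = 0) : μ = ν := by
  have hle : μ ≤ ν := Measure.le_iff.2 fun s hs => by
    have := measure_sub_le_tvW hw μ ν hs
    rw [h, nonpos_iff_eq_zero, tsub_eq_zero_iff_le] at this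
    exact this
  exact Measure.eq_of_le_of_isProbabilityMeasure hle

theorem isCausal_map_diag (μ : Measure (PathSpace d T)) [IsProbabilityMeasure μ] :
    IsCausal (μ.map fun x => (x, x)) := by
  intro t ht
  refine ⟨Kernel.id, inferInstance, ?_⟩
  rw [Measure.map_map (by fun_prop) (by fun_prop), Measure.map_map (by fun_prop) (by fun_prop)]
  have : (Prod.fst ∘ fun x : PathSpace d T => (x, x)) = id := rfl
  rw [this, Measure.map_id]
  refine Measure.ext_of_lintegral _ fun F hF => ?_
  rw [lintegral_map hF (by fun_prop), Measure.lintegral_compProd hF]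
  refine lintegral_congr fun x => ?_
  rw [Kernel.comap_apply, Kernel.id_apply, lintegral_dirac' _ (by fun_prop)]
  rfl

theorem atvW_self (w : PathSpace d T → ℝ≥0) (μ : Measure (PathSpace d T))
    [IsProbabilityMeasure μ] : atvW w μ μ = 0 := by
  have hd : Measurable fun x : PathSpace d T => (x, x) := by fun_prop
  have hid : hist (d := d) T le_rfl = id := rfl
  have hc : IsCausalCoupling μ μ T le_rfl (μ.map fun x => (x, x)) := by
    refine ⟨Measure.isProbabilityMeasure_map hd.aemeasurable, isCausal_map_diag μ, ?_, ?_, ?_⟩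
    · rw [Measure.map_map measurable_swap hd]
      exact isCausal_map_diag μ
    · rw [Measure.map_map measurable_fst hd]; rfl
    · rw [Measure.map_map measurable_snd hd]; rfl
  refine le_antisymm ((hc.atvW_le w).trans ?_) zero_le
  rw [offDiagCost, Measure.restrict_map hd measurableSet_offDiag]
  simp

theorem measurable_pathNormPow (p : ℝ) : Measurable (pathNormPow p : PathSpace d T → ℝ≥0) := by
  unfold pathNormPow stateNormPow
  fun_prop

theorem boundConst_congr {c c' : ℕ → ℝ≥0∞} (h : ∀ s ∈ Finset.Icc 2 T, c s = c' s) :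
    boundConst T c = boundConst T c' := by
  unfold boundConst
  congr 2
  refine Finset.sum_congr rfl fun t ht => Finset.prod_congr rfl fun s hs => ?_
  rw [h s]
  have := Finset.mem_Icc.1 ht
  have := Finset.mem_Icc.1 hs
  exact Finset.mem_Icc.2 ⟨by omega, by omega⟩

theorem boundConst_eq_top {c : ℕ → ℝ≥0∞} {s : ℕ} (hs : s ∈ Finset.Icc 2 T) (h : c s = ∞) :
    boundConst T c = ∞ := by
  -- The product for t = 1 contains every factor from 2 to `T`, and all factors are nonzero.
  have h1 : ∏ s ∈ Finset.Icc (1 + 1) T, (1 + c s) = ∞ := by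
    rw [← Finset.mul_prod_erase _ _ hs, h, add_top, ENNReal.top_mul]
    exact Finset.prod_ne_zero_iff.2 fun _ _ => by simp
  have h2 : (∑ t ∈ Finset.Icc 1 (T - 1), ∏ s ∈ Finset.Icc (t + 1) T, (1 + c s)) = ∞ := by
    refine ENNReal.sum_eq_top.2 ⟨1, ?_, h1⟩
    have := Finset.mem_Icc.1 hs
    exact Finset.mem_Icc.2 ⟨le_rfl, by omega⟩
  rw [boundConst, h2]
  simp

theorem pathNormPow_hist_succ (p : ℝ) {s : ℕ} (hs : s < T) (x : PathSpace d T) :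
    pathNormPow p (hist (s + 1) hs x) =
      pathNormPow p (hist s hs.le x) + stateNormPow p (x ⟨s, hs⟩) := by
  rw [pathNormPow, Fin.sum_univ_castSucc]
  rfl

theorem pathNormPow_snoc (p : ℝ) {s : ℕ} (x : PathSpace d s) (y : Fin d → ℝ) :
    pathNormPow p (Fin.snoc (α := fun _ => Fin d → ℝ) x y : PathSpace d (s + 1)) =
      pathNormPow p x + stateNormPow p y := by
  rw [pathNormPow, Fin.sum_univ_castSucc]
  simp only [Fin.snoc_castSucc, Fin.snoc_last]
  rfl

/-- The weights w_t = 1 + |x_{1:t}|_p^p work: the new state adds its p-th moment, at most c_t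
w_{t-1} by the definition of the essential supremum. -/
theorem conditionalWeighting_moment (p : ℝ) (μ ν : Measure (PathSpace d T)) [IsFiniteMeasure ν]
    (h : ∀ s ∈ Finset.Icc 2 T, momentConst p ν s ≠ ∞) :
    ConditionalWeighting μ ν (fun x => 1 + pathNormPow p x)
      fun t => (momentConst p ν t).toNNReal := by
  refine ⟨fun _ x => 1 + pathNormPow p x, fun _ => (measurable_pathNormPow p).const_add 1, rfl,
    ?_, ?_⟩
  · refine Eventually.of_forall fun x s hs _ => ?_
    simp only [pathNormPow_hist_succ]
    exact add_le_add le_rfl le_self_add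
  · rw [ae_all_iff]; intro s
    rw [ae_all_iff]; intro hs
    rw [ae_all_iff]; intro h1
    have hm : momentConst p ν (s + 1) ≠ ∞ := h _ (Finset.mem_Icc.2 ⟨by omega, hs⟩)
    rw [ENNReal.coe_toNNReal hm]
    have hmc : momentConst p ν (s + 1) = essSup (fun x : PathSpace d T =>
        (∫⁻ y, (stateNormPow p y : ℝ≥0∞) ∂(stepKernel ν s hs (hist s hs.le x))) /
          (1 + (pathNormPow p (hist s hs.le x) : ℝ≥0∞))) ν := by
      rw [momentConst, dif_pos (by simpa using hs)]
      rfl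
    filter_upwards [ENNReal.ae_le_essSup (μ := ν) fun x : PathSpace d T =>
        (∫⁻ y, (stateNormPow p y : ℝ≥0∞) ∂(stepKernel ν s hs (hist s hs.le x))) /
          (1 + (pathNormPow p (hist s hs.le x) : ℝ≥0∞))] with x hx
    rw [← hmc, ENNReal.div_le_iff (by simp) (by simp)] at hx
    simp only [pathNormPow_snoc, ENNReal.coe_add, ENNReal.coe_one, ← add_assoc]
    rw [lintegral_add_left measurable_const, lintegral_const, measure_univ, mul_one, add_mul,
      one_mul]
    exact add_le_add le_rfl hx

theorem atvP_le (hT : 1 ≤ T) {p : ℝ} (hp : 1 ≤ p) (μ ν : Measure (PathSpace d T))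
    [IsProbabilityMeasure μ] [IsProbabilityMeasure ν]
    (hμ : ∫⁻ x, (pathNormPow p x : ℝ≥0∞) ∂μ < ∞) (hν : ∫⁻ x, (pathNormPow p x : ℝ≥0∞) ∂ν < ∞) :
    atvP p μ ν ^ p ≤ boundConst T (momentConst p ν) * tvP p μ ν ^ p := by
  have hp0 : p ≠ 0 := by positivity
  rw [atvP, tvP, ← ENNReal.rpow_mul, ← ENNReal.rpow_mul, one_div_mul_cancel hp0, ENNReal.rpow_one,
    ENNReal.rpow_one]
  have hwm : Measurable fun x : PathSpace d T => 1 + pathNormPow p x :=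
    (measurable_pathNormPow p).const_add 1
  by_cases h : ∀ s ∈ Finset.Icc 2 T, momentConst p ν s ≠ ∞
  · have := atvW_le hT hwm (conditionalWeighting_moment p μ ν h) (by
      simp only [ENNReal.coe_add, ENNReal.coe_one]
      rw [lintegral_add_left measurable_const, lintegral_add_measure (μ := μ)]
      simp [hμ, hν])
    rwa [boundConst_congr (c' := momentConst p ν) fun s hs => ENNReal.coe_toNNReal (h s hs)] at this
  · push Not at h
    obtain ⟨s, hs, hsm⟩ := h
    rw [boundConst_eq_top hs hsm]
    -- With an infinite constant only the product `∞ * 0 = 0` is at issue: as the weight is at least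
    -- 1, zero distance forces `μ = ν`, and the diagonal coupling costs nothing.
    rcases eq_or_ne (tvW (fun x => 1 + pathNormPow p x) μ ν) 0 with h0 | h0
    · obtain rfl := eq_of_tvW_eq_zero (fun x => le_self_add) h0
      rw [atvW_self]; exact zero_le
    · rw [ENNReal.top_mul h0]; exact le_top

/-! ### Bicausality on atoms -/

/-- Equality of the conditional probabilities given X = x and given h(X) = h(x), multiplied out so
that null events need no separate treatment. -/
theorem measure_mul_eq_of_condDistrib {Ω A A' B : Type*} [MeasurableSpace Ω] [MeasurableSpace A]
    [MeasurableSpace A'] [MeasurableSpace B] [StandardBorelSpace B] [Nonempty B]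
    [MeasurableSingletonClass A] [MeasurableSingletonClass A']
    {P : Measure Ω} [IsFiniteMeasure P] {X : Ω → A} {Y : Ω → B} {h : A → A'}
    (hX : Measurable X) (hY : Measurable Y) (hh : Measurable h)
    (hc : ∀ᵐ ω ∂P, condDistrib Y X P (X ω) = condDistrib Y (fun ω => h (X ω)) P (h (X ω)))
    (x : A) {s : Set B} (hs : MeasurableSet s) :
    P (X ⁻¹' {x} ∩ Y ⁻¹' s) * P ((fun ω => h (X ω)) ⁻¹' {h x}) =
      P (X ⁻¹' {x}) * P ((fun ω => h (X ω)) ⁻¹' {h x} ∩ Y ⁻¹' s) := by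
  have hhX : Measurable fun ω => h (X ω) := hh.comp hX
  rw [← setLIntegral_preimage_condDistrib hX hY.aemeasurable hs (measurableSet_singleton x),
    ← setLIntegral_preimage_condDistrib hhX hY.aemeasurable hs (measurableSet_singleton (h x))]
  have h1 : ∫⁻ ω in X ⁻¹' {x}, condDistrib Y X P (X ω) s ∂P =
      condDistrib Y (fun ω => h (X ω)) P (h x) s * P (X ⁻¹' {x}) := by
    rw [← setLIntegral_const]
    refine lintegral_congr_ae ?_
    filter_upwards [ae_restrict_mem (hX (measurableSet_singleton x)), ae_restrict_of_ae hc]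
      with ω h1 h2
    rw [h2, show X ω = x from h1]
  have h2 : ∫⁻ ω in (fun ω => h (X ω)) ⁻¹' {h x},
      condDistrib Y (fun ω => h (X ω)) P (h (X ω)) s ∂P =
      condDistrib Y (fun ω => h (X ω)) P (h x) s * P ((fun ω => h (X ω)) ⁻¹' {h x}) := by
    rw [← setLIntegral_const]
    refine setLIntegral_congr_fun (hhX (measurableSet_singleton _)) fun ω hω => ?_
    rw [show h (X ω) = h x from hω]
  rw [h1, h2]
  ring

/-- Bicausality bounds the mass of a point of the diagonal by the masses of its initial segment. -/
theorem IsBicausal.diag_mul_le {μ ν : Measure (PathSpace d T)}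
    {π : Measure (PathSpace d T × PathSpace d T)} [IsFiniteMeasure π] (hb : IsBicausal π)
    (hπ : IsCoupling μ ν π) {t : ℕ} (ht : t < T) (h1 : 1 ≤ t) (x : PathSpace d T) :
    π {(x, x)} * μ (hist t ht.le ⁻¹' {hist t ht.le x}) ≤
        μ {x} * ν (hist t ht.le ⁻¹' {hist t ht.le x}) ∧
      π {(x, x)} * ν (hist t ht.le ⁻¹' {hist t ht.le x}) ≤
        ν {x} * μ (hist t ht.le ⁻¹' {hist t ht.le x}) := by
  have hm := measurable_hist (d := d) t ht.le
  have hs := measurableSet_singleton (hist t ht.le x)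
  have hsx := measurableSet_singleton x
  obtain ⟨c1, c2⟩ := hb t ht h1
  have e1 := measure_mul_eq_of_condDistrib measurable_fst (hm.comp measurable_snd) hm c1 x hs
  have e2 := measure_mul_eq_of_condDistrib measurable_snd (hm.comp measurable_fst) hm c2 x hs
  rw [← hπ.1, ← hπ.2, Measure.map_apply measurable_fst (hm hs),
    Measure.map_apply measurable_snd (hm hs), Measure.map_apply measurable_fst hsx,
    Measure.map_apply measurable_snd hsx]
  constructor
  · calc _ ≤ π (Prod.fst ⁻¹' {x} ∩
          (fun z : PathSpace d T × PathSpace d T => hist t ht.le z.2) ⁻¹' {hist t ht.le x}) *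
          π (Prod.fst ⁻¹' (hist t ht.le ⁻¹' {hist t ht.le x})) := by
          gcongr
          rintro z rfl
          exact ⟨rfl, rfl⟩
      _ = _ := e1
      _ ≤ _ := by
          gcongr
          exact Set.inter_subset_right
  · calc _ ≤ π (Prod.snd ⁻¹' {x} ∩
          (fun z : PathSpace d T × PathSpace d T => hist t ht.le z.1) ⁻¹' {hist t ht.le x}) *
          π (Prod.snd ⁻¹' (hist t ht.le ⁻¹' {hist t ht.le x})) := by
          gcongr
          rintro z rfl
          exact ⟨rfl, rfl⟩
      _ = _ := e2
      _ ≤ _ := by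
          gcongr
          exact Set.inter_subset_right

/-! ### The tree measures -/

/-- The measure with masses `g` on the paths started in `1` and `h` on those started in `-1`. -/
noncomputable def treeMeasure (d T : ℕ) (g h : Fin T → ℝ≥0) : Measure (PathSpace d T) :=
  ∑ i : Fin T, (g i • Measure.dirac (treePath d T i 1) + h i • Measure.dirac (treePath d T i (-1)))

theorem treeMu_eq (ε : ℝ) : treeMu d T ε = treeMeasure d T (fun i => (treeMass₁ T ε i).toNNReal)
    (fun i => (treeMass₂ T ε i).toNNReal) := rfl

theorem treeNu_eq (ε : ℝ) : treeNu d T ε = treeMeasure d T (fun i => (treeMass₂ T ε i).toNNReal)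
    (fun i => (treeMass₁ T ε i).toNNReal) := rfl

theorem lintegral_treeMeasure (g h : Fin T → ℝ≥0) {f : PathSpace d T → ℝ≥0∞}
    (hf : Measurable f) :
    ∫⁻ x, f x ∂(treeMeasure d T g h) =
      ∑ i, ((g i : ℝ≥0∞) * f (treePath d T i 1) + (h i : ℝ≥0∞) * f (treePath d T i (-1))) := by
  simp only [treeMeasure, lintegral_finsetSum_measure, lintegral_add_measure,
    lintegral_smul_measure, lintegral_dirac' _ hf]
  rfl

theorem treeMeasure_apply (g h : Fin T → ℝ≥0) {s : Set (PathSpace d T)} (hs : MeasurableSet s) :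
    treeMeasure d T g h s = ∑ i, ((g i : ℝ≥0∞) * s.indicator 1 (treePath d T i 1) +
      (h i : ℝ≥0∞) * s.indicator 1 (treePath d T i (-1))) := by
  rw [← lintegral_indicator_one hs, lintegral_treeMeasure _ _ (measurable_one.indicator hs)]

/-- The state of index 0 reveals the root, and the state of index `k` equals the root exactly if the
path has not left the trunk before; this identifies trunk nodes with tails of the leaves. -/
theorem hist_treePath_eq_iff (hd : 1 ≤ d) {i k : Fin T} {j j' : ℝ} :
    hist (k + 1) k.2 (treePath d T i j') = hist (k + 1) k.2 (treePath d T k j) ↔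
      j' = j ∧ k ≤ i := by
  constructor
  · intro h
    have h0 : ∀ t : Fin T, t ≤ k →
        j' + (if i < t then 1 else 0) = j + (if k < t then 1 else 0) := fun t ht =>
      congrFun (congrFun h ⟨t, Nat.lt_succ_of_le ht⟩) ⟨0, hd⟩
    have h1 := h0 ⟨0, i.pos⟩ (Nat.zero_le _)
    have hjj : j' = j := by simpa [Fin.lt_def] using h1
    refine ⟨hjj, ?_⟩
    by_contra hik
    have h2 := h0 k le_rfl
    rw [if_pos (not_le.1 hik), if_neg (lt_irrefl _), hjj] at h2
    linarith
  · rintro ⟨rfl, hk⟩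
    funext t e
    have ht : (Fin.castLE k.2 t) ≤ k := Nat.lt_succ_iff.1 t.2
    simp only [hist, treePath]
    rw [if_neg (not_lt.2 (ht.trans hk)), if_neg (not_lt.2 ht)]

theorem treePath_eq_iff (hd : 1 ≤ d) {i k : Fin T} {j j' : ℝ} :
    treePath d T i j' = treePath d T k j ↔ j' = j ∧ i = k := by
  constructor
  · intro h
    have h1 := (hist_treePath_eq_iff hd (k := k)).1 (by rw [h])
    have h2 := (hist_treePath_eq_iff hd (i := k) (k := i) (j := j') (j' := j)).1 (by rw [h])
    exact ⟨h1.1, le_antisymm h2.2 h1.2⟩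
  · rintro ⟨rfl, rfl⟩; rfl

theorem treeMeasure_singleton_one (hd : 1 ≤ d) (g h : Fin T → ℝ≥0) (k : Fin T) :
    treeMeasure d T g h {treePath d T k 1} = g k := by
  rw [treeMeasure_apply _ _ (measurableSet_singleton _)]
  simp only [Set.indicator_apply, Set.mem_singleton_iff, treePath_eq_iff hd]
  norm_num

theorem treeMeasure_singleton_neg_one (hd : 1 ≤ d) (g h : Fin T → ℝ≥0) (k : Fin T) :
    treeMeasure d T g h {treePath d T k (-1)} = h k := by
  rw [treeMeasure_apply _ _ (measurableSet_singleton _)]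
  simp only [Set.indicator_apply, Set.mem_singleton_iff, treePath_eq_iff hd]
  norm_num

theorem treeMeasure_hist_one (hd : 1 ≤ d) (g h : Fin T → ℝ≥0) (k : Fin T) :
    treeMeasure d T g h (hist (k + 1) k.2 ⁻¹' {hist (k + 1) k.2 (treePath d T k 1)}) =
      ∑ i, if k ≤ i then (g i : ℝ≥0∞) else 0 := by
  rw [treeMeasure_apply _ _ (measurable_hist _ _ (measurableSet_singleton _))]
  have hm : ∀ i (j : ℝ), treePath d T i j ∈
      hist (k + 1) k.2 ⁻¹' {hist (k + 1) k.2 (treePath d T k 1)} ↔ j = 1 ∧ k ≤ i :=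
    fun i j => hist_treePath_eq_iff hd
  refine Finset.sum_congr rfl fun i _ => ?_
  have hn : treePath d T i (-1) ∉
      hist (k + 1) k.2 ⁻¹' {hist (k + 1) k.2 (treePath d T k 1)} := fun h => by
    have := ((hm i _).1 h).1
    norm_num at this
  rw [Set.indicator_of_notMem hn]
  split_ifs with hk
  · rw [Set.indicator_of_mem ((hm i _).2 ⟨rfl, hk⟩)]
    simp
  · rw [Set.indicator_of_notMem fun h => hk ((hm i _).1 h).2]
    simp

theorem treeMeasure_hist_neg_one (hd : 1 ≤ d) (g h : Fin T → ℝ≥0) (k : Fin T) :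
    treeMeasure d T g h (hist (k + 1) k.2 ⁻¹' {hist (k + 1) k.2 (treePath d T k (-1))}) =
      ∑ i, if k ≤ i then (h i : ℝ≥0∞) else 0 := by
  rw [treeMeasure_apply _ _ (measurable_hist _ _ (measurableSet_singleton _))]
  have hm : ∀ i (j : ℝ), treePath d T i j ∈
      hist (k + 1) k.2 ⁻¹' {hist (k + 1) k.2 (treePath d T k (-1))} ↔ j = -1 ∧ k ≤ i :=
    fun i j => hist_treePath_eq_iff hd
  refine Finset.sum_congr rfl fun i _ => ?_
  have hn : treePath d T i 1 ∉
      hist (k + 1) k.2 ⁻¹' {hist (k + 1) k.2 (treePath d T k (-1))} := fun h => by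
    have := ((hm i _).1 h).1
    norm_num at this
  rw [Set.indicator_of_notMem hn]
  split_ifs with hk
  · rw [Set.indicator_of_mem ((hm i _).2 ⟨rfl, hk⟩)]
    simp
  · rw [Set.indicator_of_notMem fun h => hk ((hm i _).1 h).2]
    simp

/-! The masses. -/

theorem treeP_mem {ε : ℝ} (h0 : 0 < ε) (h1 : ε < 1) (hT : 1 ≤ T) :
    0 ≤ treeP T ε ∧ treeP T ε ≤ 1 := by
  have hx : 0 ≤ 2 * ε / (1 + ε) := by positivity
  have hx1 : 2 * ε / (1 + ε) ≤ 1 := by rw [div_le_one (by linarith)]; linarith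
  have hT' : (0 : ℝ) ≤ 1 / ((T : ℝ) - 1) := by
    have : (1 : ℝ) ≤ T := by exact_mod_cast hT
    exact div_nonneg zero_le_one (by linarith)
  exact ⟨Real.rpow_nonneg hx _, Real.rpow_le_one hx hx1 hT'⟩

theorem le_treeP_pow {ε : ℝ} (h0 : 0 < ε) (h1 : ε < 1) (hT : 1 ≤ T) :
    ε ≤ (1 + ε) / 2 * treeP T ε ^ (T - 1) := by
  obtain ⟨m, rfl⟩ := Nat.exists_eq_add_of_le' hT
  -- For `T = 1` the exponent is `1 / 0 = 0`, so q = 1 and the claim is ε ≤ (1 + ε) / 2; for larger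
  -- `T` equality holds by the choice of q.
  rcases Nat.eq_zero_or_pos m with rfl | hm
  · simp; linarith
  · have hx : 0 ≤ 2 * ε / (1 + ε) := by positivity
    have : treeP (m + 1) ε ^ (m + 1 - 1) = 2 * ε / (1 + ε) := by
      rw [treeP, Nat.add_sub_cancel]
      push_cast
      rw [add_sub_cancel_right, one_div, Real.rpow_inv_natCast_pow hx hm.ne']
    rw [this]
    field_simp
    exact le_rfl

theorem sum_treeMass₂_tail (ε : ℝ) (k : Fin T) :
    ∑ i, (if k ≤ i then treeMass₂ T ε i else 0) = (1 + ε) / 2 * treeP T ε ^ (k : ℕ) := by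
  obtain ⟨m, rfl⟩ : ∃ m, T = m + 1 := ⟨T - 1, by have := k.pos; omega⟩
  set q := treeP (m + 1) ε with hq
  have hk : (k : ℕ) ≤ m := Nat.lt_succ_iff.1 k.2
  have e1 : ∀ i : Fin (m + 1), (if k ≤ i then treeMass₂ (m + 1) ε i else 0) =
      (fun i : ℕ => if (k : ℕ) ≤ i then (1 + ε) / 2 * (q ^ i * if i + 1 < m + 1 then 1 - q else 1)
        else 0) i := fun i => rfl
  rw [Finset.sum_congr rfl fun i _ => e1 i,
    Fin.sum_univ_eq_sum_range (fun i : ℕ => if (k : ℕ) ≤ i then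
    (1 + ε) / 2 * (q ^ i * if i + 1 < m + 1 then 1 - q else 1) else 0), Finset.sum_range_succ]
  simp only [hk, if_true, lt_irrefl, if_false, mul_one]
  -- The masses q^i (1 - q) telescope; the last leaf then supplies the remaining power of q.
  have e2 : ∀ n ≤ m, ∑ i ∈ Finset.range n, (if (k : ℕ) ≤ i then
      (1 + ε) / 2 * (q ^ i * if i + 1 < m + 1 then 1 - q else 1) else 0) =
      if (k : ℕ) ≤ n then (1 + ε) / 2 * (q ^ (k : ℕ) - q ^ n) else 0 := by
    intro n
    induction n with
    | zero =>
      intro _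
      rw [Finset.sum_range_zero]
      split_ifs with h
      · rw [Nat.le_zero.1 h]; ring
      · rfl
    | succ n ih =>
      intro hn
      rw [Finset.sum_range_succ, ih (by omega), if_pos (show n + 1 < m + 1 by omega)]
      by_cases h : (k : ℕ) ≤ n
      · rw [if_pos h, if_pos h, if_pos (by omega)]; ring
      · by_cases h' : (k : ℕ) = n + 1
        · rw [if_neg h, if_neg h, if_pos h'.le, h']; ring
        · rw [if_neg h, if_neg h, if_neg (by omega)]; ring
  rw [e2 m le_rfl, if_pos hk]
  ring

theorem sum_treeMass₁_tail (ε : ℝ) (k : Fin T) :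
    ∑ i, (if k ≤ i then treeMass₁ T ε i else 0) = (1 + ε) / 2 * treeP T ε ^ (k : ℕ) - ε := by
  rw [← sum_treeMass₂_tail]
  obtain ⟨m, rfl⟩ : ∃ m, T = m + 1 := ⟨T - 1, by have := k.pos; omega⟩
  have : ∑ i : Fin (m + 1), (if i = Fin.last m then ε else 0) = ε := by simp
  conv_rhs => rw [← this]
  rw [← Finset.sum_sub_distrib]
  refine Finset.sum_congr rfl fun i _ => ?_
  rw [treeMass₁]
  by_cases hi : i = Fin.last m
  · have hk : k ≤ i := hi ▸ Fin.le_last k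
    subst hi
    simp [hk]
  · have : (i : ℕ) + 1 < m + 1 := by
      have := Fin.val_lt_last hi
      omega
    rw [if_pos this, if_neg hi]
    simp

theorem treeMass₂_nonneg {ε : ℝ} (h0 : 0 < ε) (h1 : ε < 1) (i : Fin T) :
    0 ≤ treeMass₂ T ε i := by
  obtain ⟨hq0, hq1⟩ := treeP_mem h0 h1 i.pos
  have : 0 ≤ if (i : ℕ) + 1 < T then 1 - treeP T ε else 1 := by split_ifs <;> linarith
  unfold treeMass₂
  positivity

theorem treeMass₁_nonneg {ε : ℝ} (h0 : 0 < ε) (h1 : ε < 1) (i : Fin T) :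
    0 ≤ treeMass₁ T ε i := by
  rw [treeMass₁]
  split_ifs with h
  · simpa using treeMass₂_nonneg h0 h1 i
  · rw [treeMass₂, if_neg h, mul_one, show (i : ℕ) = T - 1 by omega]
    linarith [le_treeP_pow h0 h1 i.pos]

theorem sum_coe_toNNReal_tail {g : Fin T → ℝ} (hg : ∀ i, 0 ≤ g i) (k : Fin T) :
    ∑ i, (if k ≤ i then ((g i).toNNReal : ℝ≥0∞) else 0) =
      ENNReal.ofReal (∑ i, if k ≤ i then g i else 0) := by
  rw [ENNReal.ofReal_sum_of_nonneg fun i _ => by split_ifs; exacts [hg i, le_rfl]]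
  refine Finset.sum_congr rfl fun i _ => ?_
  split_ifs
  · rfl
  · simp

theorem treeMeasure_univ (g h : Fin T → ℝ) (hg : ∀ i, 0 ≤ g i) (hh : ∀ i, 0 ≤ h i) (hT : 1 ≤ T) :
    treeMeasure d T (fun i => (g i).toNNReal) (fun i => (h i).toNNReal) Set.univ =
      ENNReal.ofReal ((∑ i, if (⟨0, hT⟩ : Fin T) ≤ i then g i else 0) +
        ∑ i, if (⟨0, hT⟩ : Fin T) ≤ i then h i else 0) := by
  rw [treeMeasure_apply _ _ MeasurableSet.univ, ENNReal.ofReal_add, ← sum_coe_toNNReal_tail hg,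
    ← sum_coe_toNNReal_tail hh, ← Finset.sum_add_distrib]
  · refine Finset.sum_congr rfl fun i _ => ?_
    simp [Fin.le_def]
  · exact Finset.sum_nonneg fun i _ => by split_ifs; exacts [hg i, le_rfl]
  · exact Finset.sum_nonneg fun i _ => by split_ifs; exacts [hh i, le_rfl]

theorem isProbabilityMeasure_treeMu {ε : ℝ} (h0 : 0 < ε) (h1 : ε < 1) (hT : 1 ≤ T) :
    IsProbabilityMeasure (treeMu d T ε) := by
  refine ⟨?_⟩
  rw [treeMu_eq, treeMeasure_univ _ _ (treeMass₁_nonneg h0 h1) (treeMass₂_nonneg h0 h1) hT,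
    sum_treeMass₁_tail, sum_treeMass₂_tail]
  norm_num
  ring

theorem isProbabilityMeasure_treeNu {ε : ℝ} (h0 : 0 < ε) (h1 : ε < 1) (hT : 1 ≤ T) :
    IsProbabilityMeasure (treeNu d T ε) := by
  refine ⟨?_⟩
  rw [treeNu_eq, treeMeasure_univ _ _ (treeMass₂_nonneg h0 h1) (treeMass₁_nonneg h0 h1) hT,
    sum_treeMass₁_tail, sum_treeMass₂_tail]
  norm_num
  ring

/-! ### A weight with the prescribed constants -/

/-- The weight that grows by the factor `1 + c_s` at each time `s` at which the path is off the
trunk. -/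
noncomputable def treeWeight (c : ℕ → ℝ≥0) (t : ℕ) (x : PathSpace d t) : ℝ≥0 :=
  open Classical in
  ∏ s : Fin t, if x s = (fun _ => 0) ∨ x s = (fun _ => 2) then 1 + c (s + 1) else 1

theorem measurable_treeWeight (c : ℕ → ℝ≥0) (t : ℕ) :
    Measurable (treeWeight (d := d) c t) := by
  classical
  refine Finset.measurable_fun_prod _ fun s _ => Measurable.ite ?_ measurable_const measurable_const
  exact (measurable_pi_apply s (measurableSet_singleton _)).union
    (measurable_pi_apply s (measurableSet_singleton _))

theorem one_le_treeWeight (c : ℕ → ℝ≥0) (t : ℕ) (x : PathSpace d t) : 1 ≤ treeWeight c t x := by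
  refine Finset.one_le_prod' fun s _ => ?_
  split_ifs
  · exact le_self_add
  · exact le_rfl

theorem treeWeight_zero (t : ℕ) : treeWeight (d := d) 0 t = fun _ => 1 := by
  funext x
  simp [treeWeight]

theorem treeWeight_snoc (c : ℕ → ℝ≥0) {s : ℕ} (x : PathSpace d s) (y : Fin d → ℝ) :
    treeWeight c s x ≤ treeWeight c (s + 1) (snocPath (x, y)) ∧
      treeWeight c (s + 1) (snocPath (x, y)) ≤ (1 + c (s + 1)) * treeWeight c s x := by
  classical
  have : treeWeight c (s + 1) (snocPath (x, y)) = treeWeight c s x *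
      if y = (fun _ => 0) ∨ y = (fun _ => 2) then 1 + c (s + 1) else 1 := by
    rw [treeWeight, Fin.prod_univ_castSucc]
    simp only [snocPath, Fin.snoc_castSucc, Fin.snoc_last]
    rfl
  rw [this]
  have h1 : (1 : ℝ≥0) ≤ 1 + c (s + 1) := le_self_add
  constructor
  · refine le_mul_of_one_le_right zero_le ?_
    split_ifs
    exacts [h1, le_rfl]
  · rw [mul_comm]
    refine mul_le_mul_left ?_ _
    split_ifs
    exacts [le_rfl, h1]

/-- Each new state multiplies the weight by a factor between 1 and 1 + c_{s+1}, so both requirements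
hold pointwise, for any measures. -/
theorem conditionalWeighting_treeWeight (μ ν : Measure (PathSpace d T)) [IsFiniteMeasure ν]
    (c : ℕ → ℝ≥0) : ConditionalWeighting μ ν (treeWeight c T) c := by
  refine ⟨treeWeight c, measurable_treeWeight c, rfl, ?_, ?_⟩
  · refine Eventually.of_forall fun x s hs _ => ?_
    rw [← snocPath_hist hs x]
    exact (treeWeight_snoc c _ _).1
  · refine Eventually.of_forall fun x s hs _ => ?_
    refine (lintegral_mono (g := fun _ => (1 + (c (s + 1) : ℝ≥0∞)) *
      (treeWeight c s (hist s hs.le x) : ℝ≥0∞)) fun y => ?_).trans ?_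
    · have := ENNReal.coe_le_coe.2 (treeWeight_snoc c (hist s hs.le x) y).2
      push_cast at this
      exact this
    · rw [lintegral_const, measure_univ, mul_one]

/-- The product `∏_{s=i+2}^T (1 + c_s)`: the weight of the path that leaves the trunk after the time
of index `i`. -/
noncomputable def leafWeight (T : ℕ) (c : ℕ → ℝ≥0) (i : ℕ) : ℝ≥0 :=
  ∏ s ∈ Finset.Icc (i + 2) T, (1 + c s)

theorem treeWeight_treePath (hd : 1 ≤ d) (c : ℕ → ℝ≥0) (i : Fin T) {j : ℝ}
    (hj : j = 1 ∨ j = -1) : treeWeight c T (treePath d T i j) = leafWeight T c i := by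
  classical
  have h1 : ∀ s : Fin T, (treePath d T i j s = (fun _ => 0) ∨ treePath d T i j s = fun _ => 2) ↔
      (i : ℕ) < s := by
    intro s
    constructor
    · intro h
      by_contra hs
      have hs' : ¬ i < s := hs
      rcases h with h | h <;> have h2 := congrFun h ⟨0, hd⟩ <;>
        simp only [treePath, if_neg hs'] at h2 <;> rcases hj with rfl | rfl <;> norm_num at h2
    · intro hs
      have hs' : i < s := hs
      rcases hj with rfl | rfl
      · right; funext e; simp only [treePath, if_pos hs']; norm_num
      · left; funext e; simp only [treePath, if_pos hs']; norm_num
  simp only [treeWeight, h1]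
  -- The index `s` stands for time s + 1, so the indices beyond `i` are the times from i + 2 on.
  rw [Fin.prod_univ_eq_prod_range (fun s : ℕ => if (i : ℕ) < s then 1 + c (s + 1) else 1),
    ← Finset.prod_filter, leafWeight]
  refine Finset.prod_nbij' (· + 1) (· - 1) ?_ ?_ ?_ ?_ ?_
  · intro s hs
    simp only [Finset.mem_filter, Finset.mem_range, Finset.mem_Icc] at *
    omega
  · intro s hs
    simp only [Finset.mem_filter, Finset.mem_range, Finset.mem_Icc] at *
    omega
  · intro s hs; simp
  · intro s hs
    simp only [Finset.mem_Icc] at *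
    omega
  · intro s hs; rfl

theorem boundConst_eq_ofReal (c : ℕ → ℝ≥0) :
    boundConst T (fun t => (c t : ℝ≥0∞)) =
      ENNReal.ofReal (1 + 2 * ∑ i ∈ Finset.range (T - 1), (leafWeight T c i : ℝ)) := by
  have h : ∑ t ∈ Finset.Icc 1 (T - 1), ∏ s ∈ Finset.Icc (t + 1) T, (1 + (c s : ℝ≥0∞)) =
      ((∑ i ∈ Finset.range (T - 1), leafWeight T c i : ℝ≥0) : ℝ≥0∞) := by
    rw [ENNReal.ofNNReal_finsetSum]
    refine Finset.sum_nbij' (· - 1) (· + 1) ?_ ?_ ?_ ?_ ?_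
    · intro s hs
      simp only [Finset.mem_range, Finset.mem_Icc] at *
      omega
    · intro s hs
      simp only [Finset.mem_range, Finset.mem_Icc] at *
      omega
    · intro s hs
      simp only [Finset.mem_Icc] at *
      omega
    · intro s hs; simp
    · intro s hs
      have : s - 1 + 2 = s + 1 := by
        have := Finset.mem_Icc.1 hs
        omega
      rw [leafWeight, this]
      push_cast
      rfl
  rw [boundConst, h, ENNReal.ofReal]
  have e : (1 + 2 * ∑ i ∈ Finset.range (T - 1), (leafWeight T c i : ℝ)) =
      ((1 + 2 * ∑ i ∈ Finset.range (T - 1), leafWeight T c i : ℝ≥0) : ℝ) := by push_cast; rfl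
  rw [e, Real.toNNReal_coe]
  push_cast
  rfl

/-! The total variation of the tree measures. -/

theorem treeMass₂_eq (h0 : 0 < T) {ε : ℝ} (i : Fin T) :
    treeMass₂ T ε i = treeMass₁ T ε i + if i = ⟨T - 1, Nat.sub_lt h0 one_pos⟩ then ε else 0 := by
  rw [treeMass₁]
  by_cases h : (i : ℕ) + 1 < T
  · rw [if_pos h, if_neg fun hi => by
      have := congrArg Fin.val hi
      simp only at this
      omega]
    ring
  · rw [if_neg h, if_pos (Fin.ext (by simp only; have := i.2; omega))]
    ring

theorem treeMeasure_add (g h g' h' : Fin T → ℝ≥0) :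
    treeMeasure d T (g + g') (h + h') = treeMeasure d T g h + treeMeasure d T g' h' := by
  simp only [treeMeasure, ← Finset.sum_add_distrib, Pi.add_apply, add_smul]
  refine Finset.sum_congr rfl fun i _ => ?_
  abel

/-- `γ₂` exceeds `γ₁` by ε at the last leaf only, so each of the two measures is a symmetric common
part plus one atom of mass ε. -/
theorem treeMu_treeNu_common_part {ε : ℝ} (h0 : 0 < ε) (h1 : ε < 1) (hT : 0 < T) :
    treeMeasure d T (fun i => (treeMass₁ T ε i).toNNReal) (fun i => (treeMass₁ T ε i).toNNReal) +
        ε.toNNReal • Measure.dirac (treePath d T ⟨T - 1, Nat.sub_lt hT one_pos⟩ (-1)) =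
          treeMu d T ε ∧
      treeMeasure d T (fun i => (treeMass₁ T ε i).toNNReal) (fun i => (treeMass₁ T ε i).toNNReal) +
        ε.toNNReal • Measure.dirac (treePath d T ⟨T - 1, Nat.sub_lt hT one_pos⟩ 1) =
          treeNu d T ε := by
  set m : Fin T := ⟨T - 1, Nat.sub_lt hT one_pos⟩ with hm
  set k : Fin T → ℝ≥0 := fun i => if i = m then ε.toNNReal else 0 with hk
  set g : Fin T → ℝ≥0 := fun i => (treeMass₁ T ε i).toNNReal with hg
  have e : (fun i => (treeMass₂ T ε i).toNNReal) = g + k := by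
    funext i
    rw [treeMass₂_eq hT, Pi.add_apply, Real.toNNReal_add (treeMass₁_nonneg h0 h1 i)
      (by split_ifs <;> linarith), hk, hg]
    simp only [apply_ite Real.toNNReal, Real.toNNReal_zero]
    rfl
  rw [treeMu_eq, treeNu_eq, e]
  have e1 : treeMeasure d T g (g + k) = treeMeasure d T g g + treeMeasure d T 0 k := by
    rw [← treeMeasure_add, add_zero]
  have e2 : treeMeasure d T (g + k) g = treeMeasure d T g g + treeMeasure d T k 0 := by
    rw [← treeMeasure_add, add_zero]
  rw [e1, e2]
  constructor
  · congr 1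
    simp [treeMeasure, hk, ite_smul]
  · congr 1
    simp [treeMeasure, hk, ite_smul]

/-- Leave `α` in place and move the atom from `u` to `v`. -/
theorem tvW_add_dirac_le {α : Measure (PathSpace d T)} {a : ℝ≥0} {u v : PathSpace d T}
    [IsProbabilityMeasure (α + a • Measure.dirac u)] {w : PathSpace d T → ℝ≥0}
    (hw : Measurable w) :
    tvW w (α + a • Measure.dirac u) (α + a • Measure.dirac v) ≤ a * (w u + w v) := by
  have hd : Measurable fun x : PathSpace d T => (x, x) := by fun_prop
  set π : Measure (PathSpace d T × PathSpace d T) :=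
    α.map (fun x => (x, x)) + a • Measure.dirac (u, v) with hπ
  have h1 : π.map Prod.fst = α + a • Measure.dirac u := by
    rw [hπ, Measure.map_add _ _ measurable_fst, Measure.map_map measurable_fst hd,
      Measure.map_smul, Measure.map_dirac' measurable_fst]
    congr 1
    exact Measure.map_id
  have h2 : π.map Prod.snd = α + a • Measure.dirac v := by
    rw [hπ, Measure.map_add _ _ measurable_snd, Measure.map_map measurable_snd hd,
      Measure.map_smul, Measure.map_dirac' measurable_snd]
    congr 1
    exact Measure.map_id
  have hp : IsProbabilityMeasure π := by
    have : IsProbabilityMeasure (π.map Prod.fst) := h1 ▸ inferInstance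
    exact Measure.isProbabilityMeasure_of_map Prod.fst
  refine iInf_le_of_le ⟨π, hp⟩ (iInf_le_of_le ⟨h1, h2⟩ ?_)
  change offDiagCost w π ≤ _
  have hf : Measurable fun z : PathSpace d T × PathSpace d T => (w z.1 : ℝ≥0∞) + w z.2 := by
    fun_prop
  rw [offDiagCost, hπ, Measure.restrict_add, lintegral_add_measure,
    Measure.restrict_map hd measurableSet_offDiag]
  have h3 : (fun x : PathSpace d T => (x, x)) ⁻¹' {z | z.1 ≠ z.2} = ∅ := by ext; simp
  rw [h3, Measure.restrict_empty, Measure.map_zero, lintegral_zero_measure, zero_add]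
  refine (setLIntegral_le_lintegral _ _).trans (le_of_eq ?_)
  rw [lintegral_smul_measure, lintegral_dirac' _ hf]
  rfl

theorem leafWeight_last (hT : 1 ≤ T) (c : ℕ → ℝ≥0) : leafWeight T c (T - 1) = 1 := by
  rw [leafWeight, Finset.Icc_eq_empty (by omega), Finset.prod_empty]

theorem tvW_tree_le (hd : 1 ≤ d) (hT : 1 ≤ T) {ε : ℝ} (h0 : 0 < ε) (h1 : ε < 1) (c : ℕ → ℝ≥0) :
    tvW (treeWeight c T) (treeMu d T ε) (treeNu d T ε) ≤ ENNReal.ofReal (2 * ε) := by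
  obtain ⟨e1, e2⟩ := treeMu_treeNu_common_part (d := d) h0 h1 hT
  have := isProbabilityMeasure_treeMu (d := d) h0 h1 hT
  rw [← e1] at this
  rw [← e1, ← e2]
  refine (tvW_add_dirac_le (measurable_treeWeight c T)).trans (le_of_eq ?_)
  rw [treeWeight_treePath hd c _ (Or.inl rfl), treeWeight_treePath hd c _ (Or.inr rfl),
    leafWeight_last hT, mul_comm 2 ε, ENNReal.ofReal_mul h0.le]
  norm_num
  rfl

theorem tv_tree_le (hT : 1 ≤ T) {ε : ℝ} (h0 : 0 < ε) (h1 : ε < 1) :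
    tv (treeMu d T ε) (treeNu d T ε) ≤ ENNReal.ofReal (2 * ε) := by
  obtain ⟨e1, e2⟩ := treeMu_treeNu_common_part (d := d) h0 h1 hT
  refine (tv_le_of_common_part e1 e2).trans (le_of_eq ?_)
  rw [two_mul, ENNReal.ofReal_add h0.le h0.le]
  rw [Measure.smul_apply, Measure.smul_apply, measure_univ, measure_univ, ENNReal.smul_def,
    smul_eq_mul, mul_one]
  rfl

theorem treeNu_sub_treeMu_pos (hd : 1 ≤ d) (hT : 1 ≤ T) {ε : ℝ} (h0 : 0 < ε) (h1 : ε < 1) :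
    0 < treeMu d T ε {treePath d T ⟨T - 1, Nat.sub_lt hT one_pos⟩ (-1)} -
      treeNu d T ε {treePath d T ⟨T - 1, Nat.sub_lt hT one_pos⟩ (-1)} := by
  rw [treeMu_eq, treeNu_eq, treeMeasure_singleton_neg_one hd, treeMeasure_singleton_neg_one hd,
    tsub_pos_iff_lt, ENNReal.coe_lt_coe, treeMass₂_eq hT, if_pos rfl]
  have := treeMass₁_nonneg h0 h1 (⟨T - 1, Nat.sub_lt hT one_pos⟩ : Fin T)
  exact (Real.toNNReal_lt_toNNReal_iff (by linarith)).2 (by linarith)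

theorem tvW_tree_pos (hd : 1 ≤ d) (hT : 1 ≤ T) {ε : ℝ} (h0 : 0 < ε) (h1 : ε < 1) (c : ℕ → ℝ≥0) :
    0 < tvW (treeWeight c T) (treeMu d T ε) (treeNu d T ε) :=
  (treeNu_sub_treeMu_pos hd hT h0 h1).trans_le
    (measure_sub_le_tvW (one_le_treeWeight c T) _ _ (measurableSet_singleton _))

theorem tv_tree_pos (hd : 1 ≤ d) (hT : 1 ≤ T) {ε : ℝ} (h0 : 0 < ε) (h1 : ε < 1) :
    0 < tv (treeMu d T ε) (treeNu d T ε) := by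
  refine pos_iff_ne_zero.2 fun h => ?_
  have := treeNu_sub_treeMu_pos hd hT h0 h1
  rw [eq_of_tv_eq_zero h, tsub_self] at this
  exact lt_irrefl _ this

theorem lintegral_tree_lt_top {ε : ℝ} {w : PathSpace d T → ℝ≥0} (hw : Measurable w) :
    ∫⁻ x, (w x : ℝ≥0∞) ∂(treeMu d T ε + treeNu d T ε) < ∞ := by
  rw [lintegral_add_measure, treeMu_eq, treeNu_eq,
    lintegral_treeMeasure _ _ hw.coe_nnreal_ennreal,
    lintegral_treeMeasure _ _ hw.coe_nnreal_ennreal]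
  refine ENNReal.add_lt_top.2 ⟨?_, ?_⟩ <;>
  · refine ENNReal.sum_lt_top.2 fun i _ => ?_
    exact_mod_cast ENNReal.coe_lt_top

/-! ### The lower bound for bicausal couplings of the tree measures -/

theorem IsCoupling.diag_le {μ ν : Measure (PathSpace d T)}
    {π : Measure (PathSpace d T × PathSpace d T)} (hπ : IsCoupling μ ν π) (x : PathSpace d T) :
    π {(x, x)} ≤ μ {x} ∧ π {(x, x)} ≤ ν {x} := by
  have hs := measurableSet_singleton x
  rw [← hπ.1, ← hπ.2, Measure.map_apply measurable_fst hs, Measure.map_apply measurable_snd hs]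
  constructor <;>
  · refine measure_mono ?_
    rintro z rfl
    exact rfl

/-- A bound for the mass that bicausal couplings of the tree measures put on a leaf of the
diagonal. -/
noncomputable def diagBound (T : ℕ) (ε : ℝ) (i : Fin T) : ℝ :=
  treeMass₁ T ε i - if (i : ℕ) + 1 < T then ε * (1 - treeP T ε) else 0

theorem tail_sub_nonneg {ε : ℝ} (h0 : 0 < ε) (h1 : ε < 1) (i : Fin T) :
    0 ≤ (1 + ε) / 2 * treeP T ε ^ (i : ℕ) - ε := by
  rw [← sum_treeMass₁_tail]
  exact Finset.sum_nonneg fun k _ => by split_ifs; exacts [treeMass₁_nonneg h0 h1 k, le_rfl]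

theorem diagBound_of_lt {ε : ℝ} {i : Fin T} (h : (i : ℕ) + 1 < T) :
    diagBound T ε i = ((1 + ε) / 2 * treeP T ε ^ (i : ℕ) - ε) * (1 - treeP T ε) := by
  rw [diagBound, treeMass₁, treeMass₂, if_pos h, if_pos h, if_pos h]
  ring

theorem diagBound_nonneg {ε : ℝ} (h0 : 0 < ε) (h1 : ε < 1) (i : Fin T) : 0 ≤ diagBound T ε i := by
  by_cases h : (i : ℕ) + 1 < T
  · rw [diagBound_of_lt h]
    exact mul_nonneg (tail_sub_nonneg h0 h1 i) (sub_nonneg.2 (treeP_mem h0 h1 i.pos).2)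
  · rw [diagBound, if_neg h, sub_zero]
    exact treeMass₁_nonneg h0 h1 i

/-- With m the larger of the two node masses, the bound `treeMass₂` (m - ε) / m equals (1 - q)(m -
ε); the division is legitimate since m ≥ ε > 0. -/
theorem le_diagBound {ε : ℝ} (h0 : 0 < ε) (h1 : ε < 1) {i : Fin T} (h : (i : ℕ) + 1 < T)
    {p : ℝ≥0∞} (hp : p * ENNReal.ofReal ((1 + ε) / 2 * treeP T ε ^ (i : ℕ)) ≤
      ENNReal.ofReal (treeMass₂ T ε i) *
        ENNReal.ofReal ((1 + ε) / 2 * treeP T ε ^ (i : ℕ) - ε)) :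
    p ≤ ENNReal.ofReal (diagBound T ε i) := by
  have hm := tail_sub_nonneg h0 h1 i
  set m := (1 + ε) / 2 * treeP T ε ^ (i : ℕ) with hmdef
  have hm0 : 0 < m := by linarith
  have e : treeMass₂ T ε i * (m - ε) = diagBound T ε i * m := by
    rw [diagBound_of_lt h, treeMass₂, if_pos h, hmdef]
    ring
  rw [← ENNReal.ofReal_mul (treeMass₂_nonneg h0 h1 i), e,
    ENNReal.ofReal_mul (diagBound_nonneg h0 h1 i)] at hp
  exact (ENNReal.mul_le_mul_iff_left (by simpa using hm0) ENNReal.ofReal_ne_top).1 hp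

/-- At a leaf below the root 1 the node is heavier under ν_ε, so causality from the second path to
the first is the binding direction; below -1 it is the other one. At the last leaf the smaller of
the two masses is the only constraint. -/
theorem IsBicausal.tree_diag_le (hd : 1 ≤ d) {ε : ℝ} (h0 : 0 < ε) (h1 : ε < 1)
    {π : Measure (PathSpace d T × PathSpace d T)} [IsFiniteMeasure π] (hb : IsBicausal π)
    (hπ : IsCoupling (treeMu d T ε) (treeNu d T ε) π) (i : Fin T) :
    π {(treePath d T i 1, treePath d T i 1)} ≤ ENNReal.ofReal (diagBound T ε i) ∧
      π {(treePath d T i (-1), treePath d T i (-1))} ≤ ENNReal.ofReal (diagBound T ε i) := by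
  by_cases h : (i : ℕ) + 1 < T
  · constructor
    · refine le_diagBound h0 h1 h ?_
      have := (hb.diag_mul_le hπ h (Nat.le_add_left 1 _) (treePath d T i 1)).2
      rw [treeMu_eq, treeNu_eq, treeMeasure_singleton_one hd, treeMeasure_hist_one hd,
        treeMeasure_hist_one hd, sum_coe_toNNReal_tail (treeMass₁_nonneg h0 h1),
        sum_coe_toNNReal_tail (treeMass₂_nonneg h0 h1), sum_treeMass₁_tail,
        sum_treeMass₂_tail] at this
      exact this
    · refine le_diagBound h0 h1 h ?_
      have := (hb.diag_mul_le hπ h (Nat.le_add_left 1 _) (treePath d T i (-1))).1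
      rw [treeMu_eq, treeNu_eq, treeMeasure_singleton_neg_one hd, treeMeasure_hist_neg_one hd,
        treeMeasure_hist_neg_one hd, sum_coe_toNNReal_tail (treeMass₁_nonneg h0 h1),
        sum_coe_toNNReal_tail (treeMass₂_nonneg h0 h1), sum_treeMass₁_tail,
        sum_treeMass₂_tail] at this
      exact this
  · rw [diagBound, if_neg h, sub_zero]
    constructor
    · refine (hπ.diag_le _).1.trans (le_of_eq ?_)
      rw [treeMu_eq, treeMeasure_singleton_one hd]
      rfl
    · refine (hπ.diag_le _).2.trans (le_of_eq ?_)
      rw [treeNu_eq, treeMeasure_singleton_neg_one hd]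
      rfl

/-- The set of the leaves of the tree carries both tree measures. -/
theorem treeMeasure_compl_leaves (g h : Fin T → ℝ≥0) :
    treeMeasure d T g h (⋃ i, ({treePath d T i 1} ∪ {treePath d T i (-1)}))ᶜ = 0 := by
  have hm : MeasurableSet (⋃ i, ({treePath d T i 1} ∪ {treePath d T i (-1)} :
      Set (PathSpace d T))) :=
    MeasurableSet.iUnion fun i => (measurableSet_singleton _).union (measurableSet_singleton _)
  rw [treeMeasure_apply _ _ hm.compl]
  refine Finset.sum_eq_zero fun i _ => ?_
  rw [Set.indicator_of_notMem, Set.indicator_of_notMem]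
  · simp
  · exact fun h => h (Set.mem_iUnion.2 ⟨i, Or.inr rfl⟩)
  · exact fun h => h (Set.mem_iUnion.2 ⟨i, Or.inl rfl⟩)

/-- The diagonal part projects to a measure below the tree measure, hence carried by the leaves.
Subadditivity over the leaves suffices, so they need not be distinct. -/
theorem lintegral_diag_tree_le {g h : Fin T → ℝ≥0} {ν : Measure (PathSpace d T)}
    {π : Measure (PathSpace d T × PathSpace d T)} (hπ : IsCoupling (treeMeasure d T g h) ν π)
    {w : PathSpace d T → ℝ≥0} (hw : Measurable w) :
    ∫⁻ z in {z : PathSpace d T × PathSpace d T | z.1 = z.2}, (w z.1 : ℝ≥0∞) ∂π ≤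
      ∑ i, ((w (treePath d T i 1) : ℝ≥0∞) * π {(treePath d T i 1, treePath d T i 1)} +
        (w (treePath d T i (-1)) : ℝ≥0∞) *
          π {(treePath d T i (-1), treePath d T i (-1))}) := by
  have hD : MeasurableSet {z : PathSpace d T × PathSpace d T | z.1 = z.2} :=
    measurableSet_eq_fun measurable_fst measurable_snd
  set σ := (π.restrict {z : PathSpace d T × PathSpace d T | z.1 = z.2}).map Prod.fst with hσ
  have hσle : σ ≤ treeMeasure d T g h := by
    rw [← hπ.1]
    exact Measure.map_mono Measure.restrict_le_self measurable_fst
  have hσx : ∀ x, σ {x} = π {(x, x)} := fun x => by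
    rw [hσ, Measure.map_apply measurable_fst (measurableSet_singleton x),
      Measure.restrict_apply (measurable_fst (measurableSet_singleton x))]
    congr 1
    ext ⟨a, b⟩
    simp only [Set.mem_inter_iff, Set.mem_preimage, Set.mem_singleton_iff, Set.mem_ofPred_eq,
      Prod.mk.injEq]
    constructor
    · rintro ⟨rfl, rfl⟩; exact ⟨rfl, rfl⟩
    · rintro ⟨rfl, rfl⟩; exact ⟨rfl, rfl⟩
  set S : Set (PathSpace d T) := ⋃ i, ({treePath d T i 1} ∪ {treePath d T i (-1)}) with hS
  have hσS : ∀ᵐ x ∂σ, x ∈ S := by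
    have : σ Sᶜ = 0 := le_antisymm ((hσle _).trans (treeMeasure_compl_leaves g h).le) zero_le
    exact this
  rw [← lintegral_map (f := fun x => (w x : ℝ≥0∞)) hw.coe_nnreal_ennreal measurable_fst, ← hσ,
    ← Measure.restrict_eq_self_of_ae_mem hσS, hS]
  refine (lintegral_iUnion_le _ _).trans ?_
  rw [tsum_fintype]
  refine Finset.sum_le_sum fun i _ => ?_
  refine (lintegral_union_le _ _ _).trans (le_of_eq ?_)
  rw [lintegral_singleton, lintegral_singleton, hσx, hσx]

theorem le_offDiagCost_tree (hd : 1 ≤ d) (hT : 1 ≤ T) {ε : ℝ} (h0 : 0 < ε) (h1 : ε < 1)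
    (c : ℕ → ℝ≥0) {π : Measure (PathSpace d T × PathSpace d T)} [IsFiniteMeasure π]
    (hb : IsBicausal π) (hπ : IsCoupling (treeMu d T ε) (treeNu d T ε) π) :
    ENNReal.ofReal (2 * ε * (1 + 2 * ((1 - treeP T ε) *
      ∑ i ∈ Finset.range (T - 1), (leafWeight T c i : ℝ)))) ≤ offDiagCost (treeWeight c T) π := by
  have hw := measurable_treeWeight (d := d) c T
  have hD := lintegral_diag_tree_le (treeMu_eq (d := d) (T := T) ε ▸ hπ) hw
  have hcost := offDiagCost_add hπ hw
  set D := ∫⁻ z in {z : PathSpace d T × PathSpace d T | z.1 = z.2},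
    (treeWeight c T z.1 : ℝ≥0∞) ∂π with hDdef
  set P : Fin T → ℝ := fun i => leafWeight T c i with hP
  have hP0 : ∀ i, 0 ≤ P i := fun i => NNReal.coe_nonneg _
  have hPc : ∀ i : Fin T, (leafWeight T c i : ℝ≥0∞) = ENNReal.ofReal (P i) := fun i =>
    (ENNReal.ofReal_coe_nnreal).symm
  have hm1 := treeMass₁_nonneg (T := T) h0 h1
  have hm2 := treeMass₂_nonneg (T := T) h0 h1
  have he := diagBound_nonneg (T := T) h0 h1
  -- The 4 comes from the factor 2 before `D` and the two leaves at each index.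
  have hD2 : 2 * D ≤ ENNReal.ofReal (∑ i, 4 * (P i * diagBound T ε i)) := by
    have h4 : (2 : ℝ≥0∞) * 2 = ENNReal.ofReal 4 := by norm_num
    rw [← Finset.mul_sum, ENNReal.ofReal_mul (by norm_num), ← h4, mul_assoc,
      ENNReal.ofReal_sum_of_nonneg fun i _ => mul_nonneg (hP0 i) (he i)]
    gcongr
    refine hD.trans ?_
    rw [Finset.mul_sum]
    refine Finset.sum_le_sum fun i _ => ?_
    rw [treeWeight_treePath hd c i (Or.inl rfl), treeWeight_treePath hd c i (Or.inr rfl), hPc,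
      ENNReal.ofReal_mul (hP0 i), two_mul]
    obtain ⟨b1, b2⟩ := hb.tree_diag_le hd h0 h1 hπ i
    gcongr
  have htot : ∫⁻ x, (treeWeight c T x : ℝ≥0∞) ∂(treeMu d T ε) +
      ∫⁻ x, (treeWeight c T x : ℝ≥0∞) ∂(treeNu d T ε) =
      ENNReal.ofReal (∑ i, 2 * (P i * (treeMass₁ T ε i + treeMass₂ T ε i))) := by
    rw [treeMu_eq, treeNu_eq, lintegral_treeMeasure _ _ hw.coe_nnreal_ennreal,
      lintegral_treeMeasure _ _ hw.coe_nnreal_ennreal, ← Finset.sum_add_distrib,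
      ENNReal.ofReal_sum_of_nonneg fun i _ => by
        have := hP0 i
        have := hm1 i
        have := hm2 i
        positivity]
    refine Finset.sum_congr rfl fun i _ => ?_
    rw [treeWeight_treePath hd c i (Or.inl rfl), treeWeight_treePath hd c i (Or.inr rfl), hPc,
      ENNReal.ofReal_mul (by norm_num), ENNReal.ofReal_mul (hP0 i),
      ENNReal.ofReal_add (hm1 i) (hm2 i), ENNReal.ofReal_ofNat]
    simp only [ENNReal.ofReal]
    ring
  -- Each leaf index before the last contributes 4ε(1 - q) times its weight; the last contributes
  -- 2ε, with weight 1.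
  have hreal : 2 * ε * (1 + 2 * ((1 - treeP T ε) *
      ∑ i ∈ Finset.range (T - 1), (leafWeight T c i : ℝ))) =
      (∑ i, 2 * (P i * (treeMass₁ T ε i + treeMass₂ T ε i))) -
        ∑ i, 4 * (P i * diagBound T ε i) := by
    have hterm : ∀ i : Fin T, 2 * (P i * (treeMass₁ T ε i + treeMass₂ T ε i)) -
        4 * (P i * diagBound T ε i) = (fun i : ℕ => (leafWeight T c i : ℝ) *
          if i + 1 < T then 4 * ε * (1 - treeP T ε) else 2 * ε) i := by
      intro i
      simp only [hP, diagBound, treeMass₁]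
      split_ifs <;> ring
    rw [← Finset.sum_sub_distrib, Finset.sum_congr rfl fun i _ => hterm i,
      Fin.sum_univ_eq_sum_range (fun i : ℕ => (leafWeight T c i : ℝ) *
          if i + 1 < T then 4 * ε * (1 - treeP T ε) else 2 * ε)]
    obtain ⟨m, rfl⟩ : ∃ m, T = m + 1 := ⟨T - 1, by omega⟩
    have hl := leafWeight_last hT c
    rw [Nat.add_sub_cancel] at hl
    have hlt : ∀ i ∈ Finset.range m, ((leafWeight (m + 1) c i : ℝ) *
        if i + 1 < m + 1 then 4 * ε * (1 - treeP (m + 1) ε) else 2 * ε) =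
        leafWeight (m + 1) c i * (4 * ε * (1 - treeP (m + 1) ε)) := fun i hi => by
      rw [if_pos (Nat.succ_lt_succ (Finset.mem_range.1 hi))]
    rw [Finset.sum_range_succ, hl, Nat.add_sub_cancel, Finset.sum_congr rfl hlt,
      ← Finset.sum_mul, if_neg (lt_irrefl _), NNReal.coe_one]
    ring
  rw [hreal, ENNReal.ofReal_sub _ (Finset.sum_nonneg fun i _ => by
    have := hP0 i
    have := he i
    positivity), ← htot, ← hcost, tsub_le_iff_right]
  exact add_le_add le_rfl hD2

theorem le_atvW_tree (hd : 1 ≤ d) (hT : 1 ≤ T) {ε : ℝ} (h0 : 0 < ε) (h1 : ε < 1) (c : ℕ → ℝ≥0) :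
    ENNReal.ofReal (2 * ε * (1 + 2 * ((1 - treeP T ε) *
      ∑ i ∈ Finset.range (T - 1), (leafWeight T c i : ℝ)))) ≤
      atvW (treeWeight c T) (treeMu d T ε) (treeNu d T ε) :=
  le_iInf fun _ => le_iInf fun hπ => le_iInf fun hb => le_offDiagCost_tree hd hT h0 h1 c hb hπ

/-! ### The limit of the ratio -/

theorem tendsto_treeP (hT : 2 ≤ T) : Tendsto (treeP T) (𝓝[>] 0) (𝓝 0) := by
  have hpos : 0 < 1 / ((T : ℝ) - 1) := by
    have : (2 : ℝ) ≤ T := by exact_mod_cast hT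
    exact one_div_pos.2 (by linarith)
  have h1 : ContinuousAt (fun ε : ℝ => 2 * ε / (1 + ε)) 0 :=
    ContinuousAt.div (by fun_prop) (by fun_prop) (by norm_num)
  have h2 := h1.rpow_const (p := 1 / ((T : ℝ) - 1)) (Or.inr hpos.le)
  have h3 := h2.tendsto.mono_left (nhdsWithin_le_nhds (s := Set.Ioi (0 : ℝ)))
  simp only [mul_zero, zero_div, Real.zero_rpow hpos.ne'] at h3
  exact h3

/-- A squeeze: the lower bound on `A` divided by 2ε ≥ `V` tends to the constant, and the proved
inequality is the upper bound. For `T = 1` the parameter q stays at 1, but then the sum `S`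
vanishes. -/
theorem tendsto_div_of_tree_bounds {A V : ℝ → ℝ≥0∞} {S : ℝ} (hS0 : T < 2 → S = 0)
    (hA : ∀ ε : ℝ, 0 < ε → ε < 1 →
      ENNReal.ofReal (2 * ε * (1 + 2 * ((1 - treeP T ε) * S))) ≤ A ε)
    (hAV : ∀ ε : ℝ, 0 < ε → ε < 1 → A ε ≤ ENNReal.ofReal (1 + 2 * S) * V ε)
    (hV : ∀ ε : ℝ, 0 < ε → ε < 1 → V ε ≤ ENNReal.ofReal (2 * ε))
    (hV0 : ∀ ε : ℝ, 0 < ε → ε < 1 → 0 < V ε) :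
    Tendsto (fun ε => A ε / V ε) (𝓝[>] 0) (𝓝 (ENNReal.ofReal (1 + 2 * S))) := by
  have hq : Tendsto (fun ε => ENNReal.ofReal (1 + 2 * ((1 - treeP T ε) * S))) (𝓝[>] 0)
      (𝓝 (ENNReal.ofReal (1 + 2 * S))) := by
    refine ENNReal.tendsto_ofReal ?_
    rcases lt_or_ge T 2 with h | h
    · simp [hS0 h]
    · have := ((((tendsto_treeP h).const_sub 1).mul_const S).const_mul 2).const_add 1
      simpa using this
  have hI : Set.Ioo (0 : ℝ) 1 ∈ 𝓝[>] (0 : ℝ) := Ioo_mem_nhdsGT one_pos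
  refine tendsto_of_tendsto_of_tendsto_of_le_of_le' hq tendsto_const_nhds ?_ ?_
  · filter_upwards [hI] with ε hε
    have hV1 := hV ε hε.1 hε.2
    refine (ENNReal.le_div_iff_mul_le (Or.inl (hV0 ε hε.1 hε.2).ne')
      (Or.inl (ne_top_of_le_ne_top ENNReal.ofReal_ne_top hV1))).2 ?_
    refine le_trans ?_ (hA ε hε.1 hε.2)
    have := hε.1
    rw [mul_comm, ENNReal.ofReal_mul (by positivity)]
    gcongr
  · filter_upwards [hI] with ε hε
    exact ENNReal.div_le_of_le_mul (hAV ε hε.1 hε.2)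

end AdaptedTV

theorem theorem2p5 (d T : ℕ) (hd : 1 ≤ d) (hT : 1 ≤ T) :
    -- the weighted inequality
    (∀ (μ ν : Measure (PathSpace d T)) [IsProbabilityMeasure μ] [IsProbabilityMeasure ν]
      (w : PathSpace d T → ℝ≥0) (c : ℕ → ℝ≥0), Measurable w →
      ConditionalWeighting μ ν w c → ∫⁻ x, (w x : ℝ≥0∞) ∂(μ + ν) < ∞ →
      atvW w μ ν ≤ boundConst T (fun t => (c t : ℝ≥0∞)) * tvW w μ ν) ∧
    -- the case `w = 1`
    (∀ (μ ν : Measure (PathSpace d T)) [IsProbabilityMeasure μ] [IsProbabilityMeasure ν],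
      atv μ ν ≤ ((2 * T - 1 : ℕ) : ℝ≥0∞) * tv μ ν) ∧
    -- the case `w(x) = 1 + |x|_p^p`
    (∀ (p : ℝ), 1 ≤ p →
      ∀ (μ ν : Measure (PathSpace d T)) [IsProbabilityMeasure μ] [IsProbabilityMeasure ν],
      ∫⁻ x, (pathNormPow p x : ℝ≥0∞) ∂μ < ∞ → ∫⁻ x, (pathNormPow p x : ℝ≥0∞) ∂ν < ∞ →
      atvP p μ ν ^ p ≤ boundConst T (momentConst p ν) * tvP p μ ν ^ p) ∧
    -- sharpness of the weighted inequality, for all constants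
    (∀ c : ℕ → ℝ≥0, ∃ w : PathSpace d T → ℝ≥0, Measurable w ∧
      (∀ ε : ℝ, 0 < ε → ε < 1 →
        IsProbabilityMeasure (treeMu d T ε) ∧ IsProbabilityMeasure (treeNu d T ε) ∧
        ConditionalWeighting (treeMu d T ε) (treeNu d T ε) w c ∧
        ∫⁻ x, (w x : ℝ≥0∞) ∂(treeMu d T ε + treeNu d T ε) < ∞ ∧
        0 < tvW w (treeMu d T ε) (treeNu d T ε) ∧
        tvW w (treeMu d T ε) (treeNu d T ε) < ∞) ∧
      Tendsto (fun ε : ℝ => atvW w (treeMu d T ε) (treeNu d T ε) /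
          tvW w (treeMu d T ε) (treeNu d T ε))
        (𝓝[>] 0) (𝓝 (boundConst T (fun t => (c t : ℝ≥0∞))))) ∧
    -- sharpness of the inequality for `w = 1`
    ((∀ ε : ℝ, 0 < ε → ε < 1 →
        0 < tv (treeMu d T ε) (treeNu d T ε) ∧ tv (treeMu d T ε) (treeNu d T ε) < ∞) ∧
      Tendsto (fun ε : ℝ => atv (treeMu d T ε) (treeNu d T ε) /
          tv (treeMu d T ε) (treeNu d T ε))
        (𝓝[>] 0) (𝓝 ((2 * T - 1 : ℕ) : ℝ≥0∞))) := by
  have hS0 : ∀ c : ℕ → ℝ≥0, T < 2 → ∑ i ∈ Finset.range (T - 1), (leafWeight T c i : ℝ) = 0 := by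
    intro c h
    rw [show T - 1 = 0 by omega, Finset.sum_range_zero]
  refine ⟨fun μ ν _ _ w c hw hcw hint => atvW_le hT hw hcw hint, fun μ ν _ _ => atv_le hT μ ν,
    fun p hp μ ν _ _ hμ hν => atvP_le hT hp μ ν hμ hν, fun c => ?_, ?_, ?_⟩
  · refine ⟨treeWeight c T, measurable_treeWeight c T, fun ε h0 h1 =>
      ⟨isProbabilityMeasure_treeMu h0 h1 hT, isProbabilityMeasure_treeNu h0 h1 hT,
        conditionalWeighting_treeWeight _ _ c, lintegral_tree_lt_top (measurable_treeWeight c T),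
        tvW_tree_pos hd hT h0 h1 c,
        (tvW_tree_le hd hT h0 h1 c).trans_lt ENNReal.ofReal_lt_top⟩, ?_⟩
    rw [boundConst_eq_ofReal]
    refine tendsto_div_of_tree_bounds (hS0 c) (fun ε h0 h1 => le_atvW_tree hd hT h0 h1 c)
      (fun ε h0 h1 => ?_) (fun ε h0 h1 => tvW_tree_le hd hT h0 h1 c)
      (fun ε h0 h1 => tvW_tree_pos hd hT h0 h1 c)
    have := isProbabilityMeasure_treeMu (d := d) h0 h1 hT
    have := isProbabilityMeasure_treeNu (d := d) h0 h1 hT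
    rw [← boundConst_eq_ofReal]
    exact atvW_le hT (measurable_treeWeight c T) (conditionalWeighting_treeWeight _ _ c)
      (lintegral_tree_lt_top (measurable_treeWeight c T))
  · exact fun ε h0 h1 =>
      ⟨tv_tree_pos hd hT h0 h1, (tv_tree_le hT h0 h1).trans_lt ENNReal.ofReal_lt_top⟩
  · have hC : ((2 * T - 1 : ℕ) : ℝ≥0∞) = ENNReal.ofReal
        (1 + 2 * ∑ i ∈ Finset.range (T - 1), (leafWeight T 0 i : ℝ)) := by
      rw [← boundConst_zero hT, ← boundConst_eq_ofReal]
      rfl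
    rw [hC]
    refine tendsto_div_of_tree_bounds (hS0 0) (fun ε h0 h1 => ?_) (fun ε h0 h1 => ?_)
      (fun ε h0 h1 => tv_tree_le hT h0 h1) (fun ε h0 h1 => tv_tree_pos hd hT h0 h1)
    · have := le_atvW_tree hd hT h0 h1 0
      rwa [treeWeight_zero] at this
    · have := isProbabilityMeasure_treeMu (d := d) h0 h1 hT
      have := isProbabilityMeasure_treeNu (d := d) h0 h1 hT
      rw [← hC]
      exact atv_le hT _ _
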